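/- Let $n\ge 2$, let $A,B,C$ be complex $n\times n$ matrices with $B$ and $C$ symmetric, and let $M\subset\mathbb C^n\times\mathbb C$ be the quadric given in coordinates $(z,w)$ by $$w=Q(z,\bar z)=z^*Az+\overline{z^tBz}+z^tCz .$$ Assume $\bar\partial Q\not\equiv0$. Here $T^{0,1}_pM=(\mathbb C\otimes T_pM)\cap\operatorname{span}_{\mathbb C}\{\partial/\partial\bar z_1,\dots,\partial/\partial\bar z_n,\partial/\partial\bar w\}$, $M_{CR}$ is the set of points of $M$ near which $\dim T^{0,1}_pM$ is constant, and a function $f(z,\bar z)$, regarded as a function on $M$ parametrized by $z$, is called CR if it is annihilated by $T^{0,1}_pM$ for every $p\in M_{CR}$. The following are equivalent. (a) $\operatorname{rank}\begin{bmatrix}A^*\\B\end{bmatrix}\ge2$. (b) For every polynomial $f(z,\bar z)$ that is CR there is a unique holomorphic polynomial $F(z,w)$ with $f(z,\bar z)=F(z,Q(z,\bar z))$ for all $z$. Moreover, the degree of $f$ equals the weighted degree of $F$, where each $z_k$ has weight one and $w$ has weight two, and if $f$ is homogeneous of degree $d$, then $F$ is weighted homogeneous of degree $d$. (c) Every real-linear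 function $h:\mathbb C^n\to\mathbb C$ that is CR is holomorphic, that is, independent of $\bar z_1,\dots,\bar z_n$. (d) $M$ is not biholomorphically equivalent to any of the exceptional quadrics (1) $w=\bar z_1z_2+\bar z_1^2$, (2) $w=\bar z_1z_2$, (3) $w=|z_1|^2+a\bar z_1^2$ for some $a\ge0$, (4) $w=\bar z_1^2$. In (d), biholomorphic equivalence can be taken either locally (a biholomorphic map between neighborhoods of the origin, fixing the origin, that maps one germ onto the other) or globally (a biholomorphic map of $\mathbb C^{n+1}$ onto itself that takes one quadric onto the other): both versions of (d) are equivalent to (a)–(c). Furthermore, the exceptional quadrics (1), (2), (3) (one for each $a\ge0$), (4) are mutually inequivalent, both locally and globally. -/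

import Mathlib

open scoped TensorProduct Topology NNReal ComplexConjugate
open Complex

noncomputable section

namespace CRQuadric

section ComplexifiedVectors

variable {E : Type*} [NormedAddCommGroup E] [NormedSpace ℂ E] [NormedSpace ℝ E]

/-- The complexified tangent vector `∂/∂ū = ½ (u + i · Ju)` in `ℂ ⊗ E` attached to a direction `u`
of a complex vector space `E`; here `J` is multiplication by `I` in `E`, while the outer `i` is the
scalar of the complexification. For `u` the `k`-th unit vector of `ℂⁿ` this is
`∂/∂z̄ₖ = ½ (∂/∂xₖ + i ∂/∂yₖ)`. -/
def delBar (u : E) : ℂ ⊗[ℝ] E :=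
  (1 / 2 : ℂ) • ((1 : ℂ) ⊗ₜ[ℝ] u + I ⊗ₜ[ℝ] (I • u))

variable (E) in
/-- The complex span of all the `∂/∂z̄ₖ`: the vectors of type `(0,1)` in `ℂ ⊗ E`. -/
def typeZeroOne : Submodule ℂ (ℂ ⊗[ℝ] E) :=
  Submodule.span ℂ (Set.range (delBar : E → ℂ ⊗[ℝ] E))

/-- `V g` at the point `p`: the action of a complexified tangent vector `V` at `p` on a complex
valued function `g`, that is, the complex linear extension of the real differential of `g`. -/
def act (g : E → ℂ) (p : E) (V : ℂ ⊗[ℝ] E) : ℂ :=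
  LinearMap.liftBaseChange ℂ (fderiv ℝ g p : E →ₗ[ℝ] ℂ) V

end ComplexifiedVectors

section Graphs

variable {n : ℕ}

/-- The parametrization `z ↦ (z, ρ(z, z̄))` of the submanifold `w = ρ(z, z̄)` of `ℂⁿ × ℂ`. -/
def graphMap (ρ : (Fin n → ℂ) → ℂ) (z : Fin n → ℂ) : (Fin n → ℂ) × ℂ := (z, ρ z)

/-- The submanifold `w = ρ(z, z̄)` of `ℂⁿ × ℂ`. -/
def graph (ρ : (Fin n → ℂ) → ℂ) : Set ((Fin n → ℂ) × ℂ) := {p | p.2 = ρ p.1}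

/-- The real tangent space of `M : w = ρ(z, z̄)` at the point with parameter `z`. -/
def tangent (ρ : (Fin n → ℂ) → ℂ) (z : Fin n → ℂ) : Submodule ℝ ((Fin n → ℂ) × ℂ) :=
  LinearMap.range (fderiv ℝ (graphMap ρ) z : (Fin n → ℂ) →ₗ[ℝ] (Fin n → ℂ) × ℂ)

/-- `T^{0,1} M = (ℂ ⊗ T M) ∩ span {∂/∂z̄₁, …, ∂/∂z̄ₙ, ∂/∂w̄}` at the point with parameter `z`. -/
def tangentZeroOne (ρ : (Fin n → ℂ) → ℂ) (z : Fin n → ℂ) :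
    Submodule ℂ (ℂ ⊗[ℝ] ((Fin n → ℂ) × ℂ)) :=
  (tangent ρ z).baseChange ℂ ⊓ typeZeroOne ((Fin n → ℂ) × ℂ)

/-- The point of `M` with parameter `z` belongs to `M_CR`: near it `T^{0,1} M` has constant
dimension. -/
def IsCRPoint (ρ : (Fin n → ℂ) → ℂ) (z : Fin n → ℂ) : Prop :=
  ∀ᶠ z' in 𝓝 z,
    Module.finrank ℂ (tangentZeroOne ρ z') = Module.finrank ℂ (tangentZeroOne ρ z)

/-- A function `f` of `z`, regarded as a function on `M : w = ρ(z, z̄)` through the parametrization,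
is CR on `M_CR`: at every CR point it is killed by each complexified vector `V` in the parameters
which represents (is pushed forward by the parametrization to) a vector of `T^{0,1} M`. -/
def IsCR (ρ f : (Fin n → ℂ) → ℂ) : Prop :=
  ∀ z, IsCRPoint ρ z → ∀ V : ℂ ⊗[ℝ] (Fin n → ℂ),
    LinearMap.baseChange ℂ
        (fderiv ℝ (graphMap ρ) z : (Fin n → ℂ) →ₗ[ℝ] (Fin n → ℂ) × ℂ) V ∈ tangentZeroOne ρ z →
      act f z V = 0

/-- The germs at the origin of two subsets of `ℂⁿ × ℂ` correspond to each other under a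
biholomorphic map between neighborhoods of the origin which fixes the origin. -/
def LocallyBiholomorphic (M M' : Set ((Fin n → ℂ) × ℂ)) : Prop :=
  ∃ φ : OpenPartialHomeomorph ((Fin n → ℂ) × ℂ) ((Fin n → ℂ) × ℂ),
    0 ∈ φ.source ∧ φ 0 = 0 ∧
    DifferentiableOn ℂ φ φ.source ∧ DifferentiableOn ℂ φ.symm φ.target ∧
    ∀ p ∈ φ.source, φ p ∈ M' ↔ p ∈ M

/-- A biholomorphic map of `ℂⁿ × ℂ` onto itself takes one subset onto the other. -/
def GloballyBiholomorphic (M M' : Set ((Fin n → ℂ) × ℂ)) : Prop :=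
  ∃ φ : ((Fin n → ℂ) × ℂ) ≃ ((Fin n → ℂ) × ℂ),
    Differentiable ℂ φ ∧ Differentiable ℂ φ.symm ∧ φ '' M = M'

end Graphs

section Polynomials

variable {n : ℕ}

/-- The function `f(z, z̄)` given by a polynomial in the `z`'s (left variables) and the `z̄`'s
(right variables). -/
def evalBar (f : MvPolynomial (Fin n ⊕ Fin n) ℂ) (z : Fin n → ℂ) : ℂ :=
  MvPolynomial.eval (Sum.elim z fun k => conj (z k)) f

/-- The value `F(z, w)` of a holomorphic polynomial in the `z`'s (left variables) and `w` (the
right variable). -/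
def evalHol (F : MvPolynomial (Fin n ⊕ Unit) ℂ) (z : Fin n → ℂ) (w : ℂ) : ℂ :=
  MvPolynomial.eval (Sum.elim z fun _ => w) F

/-- The weights of the variables of `F(z, w)`: one for each `zₖ` and two for `w`. -/
def weight : Fin n ⊕ Unit → ℕ := Sum.elim (fun _ => 1) fun _ => 2

end Polynomials

section Quadrics

variable {n : ℕ}

/-- `Q(z, z̄) = z* A z + conj (zᵗ B z) + zᵗ C z`. -/
def quadric (A B C : Matrix (Fin n) (Fin n) ℂ) (z : Fin n → ℂ) : ℂ :=
  star z ⬝ᵥ A.mulVec z + conj (z ⬝ᵥ B.mulVec z) + z ⬝ᵥ C.mulVec z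

/-- Labels of the exceptional quadrics. -/
inductive Exceptional : Type
  | one : Exceptional
  | two : Exceptional
  | three (a : ℝ≥0) : Exceptional
  | four : Exceptional

/-- The right-hand sides of the equations of the exceptional quadrics:
(1) `z̄₁ z₂ + z̄₁²`, (2) `z̄₁ z₂`, (3) `|z₁|² + a z̄₁²` with `a ≥ 0`, (4) `z̄₁²`. -/
def Exceptional.fn (hn : 2 ≤ n) : Exceptional → (Fin n → ℂ) → ℂ
  | .one, z => conj (z ⟨0, by omega⟩) * z ⟨1, by omega⟩ + conj (z ⟨0, by omega⟩) ^ 2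
  | .two, z => conj (z ⟨0, by omega⟩) * z ⟨1, by omega⟩
  | .three a, z =>
      ((‖z ⟨0, by omega⟩‖ ^ 2 : ℝ) : ℂ) + ((a : ℝ) : ℂ) * conj (z ⟨0, by omega⟩) ^ 2
  | .four, z => conj (z ⟨0, by omega⟩) ^ 2

end Quadrics

end CRQuadric

end

open CRQuadric

/-! Everything rests on the forms `Qₖ = ∂Q/∂z̄ₖ`, which are linear in `(z, z̄)`. Up to conjugation
and a factor 2 on the `B` half, their coefficient vectors are the columns of `[A*; B]`, so rank at
most one means that all `Qₖ` are multiples of a single form. The CR dimension is `n - 1` where some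
`Qₖ` is nonzero and `n` where all vanish; a polynomial `f` that is CR therefore satisfies `fₖ Qₗ =
fₗ Qₖ`, with `fₖ = ∂f/∂z̄ₖ` (`IsCR.pderiv_mul_barGrad`).

If the rank is at least two, a nonzero `Qₖ` is prime and does not divide every `Qₗ`, hence `∂̄f = g
∂̄Q` with `g` a polynomial (`exists_mul_barGrad`). Symmetry of mixed derivatives shows that `g`
satisfies the same equations. By induction on the degree `g = G(z, Q)`, and for an antiderivative
`H` of `G` in `w` the difference `f - H(z, Q)` is holomorphic (`mem_range_substHom`). Uniqueness and
the degree statements follow from injectivity of `F ↦ F(z, Q)` and homogeneity of `Q`. A linear `h`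
then has `F` of weight one, which leaves no room for `w`.

If the rank is at most one, `Q = conj(r·z)(α·z) + b conj(r·z)² +` a holomorphic term
(`exists_factorization`). Then `conj(r·z)` is CR without being holomorphic, and a linear change of
`z` with a shear and scaling of `w` reaches an exceptional quadric.

Conversely, the 2-jet of a biholomorphism of germs forces its linear part to match the sesquilinear
and antiholomorphic parts up to one common factor (`linearlyEquivalent_of_germ`). This preserves the
rank, which is at most one for the exceptional quadrics, and reduces their inequivalence to
elementary comparisons. -/

namespace CRQuadric

/-! ### Vectors of type (0,1) in the complexification. -/

section TypeZeroOne

open Module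

variable {E : Type*} [NormedAddCommGroup E] [NormedSpace ℂ E] [NormedSpace ℝ E]

lemma act_delBar (g : E → ℂ) (p u : E) :
    act g p (delBar u) = 1 / 2 * (fderiv ℝ g p u + I * fderiv ℝ g p (I • u)) := by
  simp only [act, delBar, map_smul, map_add, LinearMap.liftBaseChange_tmul, smul_eq_mul, one_mul]
  rfl

lemma delBar_mem (u : E) : delBar u ∈ typeZeroOne E :=
  Submodule.subset_span ⟨u, rfl⟩

variable [IsScalarTower ℝ ℂ E]

variable (E) in
/-- The natural map `ℂ ⊗ E → E` which sends `c ⊗ u` to `c • u`. -/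
noncomputable def mulMap : ℂ ⊗[ℝ] E →ₗ[ℂ] E := LinearMap.liftBaseChange ℂ (LinearMap.id : E →ₗ[ℝ] E)

@[simp] lemma mulMap_tmul (c : ℂ) (u : E) : mulMap E (c ⊗ₜ u) = c • u := rfl

@[simp] lemma mulMap_delBar (u : E) : mulMap E (delBar u) = 0 := by
  simp [delBar, smul_smul]

variable (E) in
/-- The complex linear map `u ↦ 1 ⊗ u - i ⊗ iu`, twice the `(1,0)` part of `1 ⊗ u`. -/
noncomputable def twoDel : E →ₗ[ℂ] ℂ ⊗[ℝ] E where
  toFun u := (1 : ℂ) ⊗ₜ[ℝ] u - I ⊗ₜ[ℝ] (I • u)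
  map_add' u v := by simp only [smul_add, TensorProduct.tmul_add]; abel
  map_smul' c u := by
    have h : ∀ v : E, (c • v) = c.re • v + c.im • (I • v) := by
      intro v
      conv_lhs => rw [← Complex.re_add_im c, add_smul, mul_smul]
      congr 1
      · exact (algebraMap_smul ℂ c.re v)
      · exact (algebraMap_smul ℂ c.im (I • v))
    have hI : I • (c • u) = c.re • (I • u) - c.im • u := by
      rw [smul_comm, h (I • u), smul_smul I I u, I_mul_I, neg_one_smul, smul_neg, sub_eq_add_neg]
    have key : ∀ (a : ℝ) (b : ℂ) (v : E), b ⊗ₜ[ℝ] (a • v) = ((a : ℂ) * b) ⊗ₜ[ℝ] v := by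
      intro a b v
      rw [← TensorProduct.smul_tmul, real_smul]
    rw [hI, h u]
    simp only [TensorProduct.tmul_add, TensorProduct.tmul_sub, key, smul_sub,
      TensorProduct.smul_tmul', smul_eq_mul, RingHom.id_apply]
    have e1 : (c * 1) ⊗ₜ[ℝ] u = ((c.re : ℂ) * 1) ⊗ₜ[ℝ] u + ((c.im : ℂ) * I) ⊗ₜ[ℝ] u := by
      rw [← TensorProduct.add_tmul, mul_one, mul_one, Complex.re_add_im]
    have e2 : (c * I) ⊗ₜ[ℝ] (I • u) =
        ((c.re : ℂ) * I) ⊗ₜ[ℝ] (I • u) - ((c.im : ℂ) * 1) ⊗ₜ[ℝ] (I • u) := by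
      rw [← TensorProduct.sub_tmul]
      congr 1
      conv_lhs => rw [← Complex.re_add_im c]
      linear_combination (c.im : ℂ) * I_mul_I
    rw [e1, e2]
    abel

variable (E) in
-- The vector `x - ½ twoDel (mulMap x)` is the (0,1) part of `x`: on `c ⊗ u` it equals `c • delBar
-- u`. If `mulMap x = 0`, it is `x` itself. The (0,1) condition thereby becomes an equation.
lemma typeZeroOne_eq_ker : typeZeroOne E = LinearMap.ker (mulMap E) := by
  apply le_antisymm
  · rw [typeZeroOne, Submodule.span_le]
    rintro _ ⟨u, rfl⟩
    exact mulMap_delBar u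
  · have h : ∀ x : ℂ ⊗[ℝ] E, x - (1 / 2 : ℂ) • twoDel E (mulMap E x) ∈ typeZeroOne E := by
      intro x
      induction x using TensorProduct.induction_on with
      | zero => simp
      | add x y hx hy =>
        rw [map_add, map_add, smul_add, add_sub_add_comm]
        exact add_mem hx hy
      | tmul c u =>
        have : c ⊗ₜ[ℝ] u - (1 / 2 : ℂ) • twoDel E (mulMap E (c ⊗ₜ u)) = c • delBar u := by
          have e : c ⊗ₜ[ℝ] u = c • ((1 : ℂ) ⊗ₜ[ℝ] u) := by
            rw [TensorProduct.smul_tmul', smul_eq_mul, mul_one]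
          rw [mulMap_tmul, map_smul, e, delBar, smul_comm, ← smul_sub]
          congr 1
          change _ - (1 / 2 : ℂ) • ((1 : ℂ) ⊗ₜ[ℝ] u - I ⊗ₜ[ℝ] (I • u)) = _
          rw [smul_sub, smul_add]
          have : (1 : ℂ) ⊗ₜ[ℝ] u = (1 / 2 : ℂ) • ((1 : ℂ) ⊗ₜ[ℝ] u) + (1 / 2 : ℂ) • ((1 : ℂ) ⊗ₜ[ℝ] u) := by
            rw [← add_smul]; norm_num
          nth_rw 1 [this]
          abel
        rw [this]
        exact Submodule.smul_mem _ _ (delBar_mem u)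
    intro x hx
    have := h x
    rwa [LinearMap.mem_ker.1 hx, map_zero, smul_zero, sub_zero] at this

lemma mulMap_surjective : Function.Surjective (mulMap E) := fun u => ⟨1 ⊗ₜ u, by simp⟩

variable (E) in
lemma finrank_typeZeroOne [FiniteDimensional ℂ E] :
    finrank ℂ (typeZeroOne E) = finrank ℂ E := by
  have : FiniteDimensional ℝ E := FiniteDimensional.trans ℝ ℂ E
  have h := LinearMap.finrank_range_add_finrank_ker (mulMap E)
  rw [LinearMap.range_eq_top.2 mulMap_surjective, finrank_top, finrank_baseChange,
    ← typeZeroOne_eq_ker, ← finrank_mul_finrank ℝ ℂ E, finrank_real_complex] at h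
  omega

end TypeZeroOne

/-! ### The (0,1) tangent space of a graph and its dimension. -/

section TangentZeroOne

open Module

variable {n : ℕ} {ρ : (Fin n → ℂ) → ℂ} {z : Fin n → ℂ}

/-- The push forward of complexified tangent vectors by the parametrization of a graph. -/
noncomputable def graphPush (ρ : (Fin n → ℂ) → ℂ) (z : Fin n → ℂ) :
    ℂ ⊗[ℝ] (Fin n → ℂ) →ₗ[ℂ] ℂ ⊗[ℝ] ((Fin n → ℂ) × ℂ) :=
  LinearMap.baseChange ℂ
    (fderiv ℝ (graphMap ρ) z : (Fin n → ℂ) →ₗ[ℝ] (Fin n → ℂ) × ℂ)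

/-- The action of complexified tangent vectors on `ρ`, as a linear functional. -/
noncomputable def actMap (ρ : (Fin n → ℂ) → ℂ) (z : Fin n → ℂ) : ℂ ⊗[ℝ] (Fin n → ℂ) →ₗ[ℂ] ℂ :=
  LinearMap.liftBaseChange ℂ (fderiv ℝ ρ z : (Fin n → ℂ) →ₗ[ℝ] ℂ)

lemma actMap_apply (V : ℂ ⊗[ℝ] (Fin n → ℂ)) : actMap ρ z V = act ρ z V := rfl

lemma fderiv_graphMap (h : DifferentiableAt ℝ ρ z) (u : Fin n → ℂ) :
    fderiv ℝ (graphMap ρ) z u = (u, fderiv ℝ ρ z u) := by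
  have : HasFDerivAt (graphMap ρ)
      ((ContinuousLinearMap.id ℝ (Fin n → ℂ)).prod (fderiv ℝ ρ z)) z :=
    (hasFDerivAt_id z).prodMk h.hasFDerivAt
  rw [this.fderiv]; rfl

/-- Splits the (0,1) condition on a pushed-forward vector into the (0,1) condition on `V` and the
scalar equation `V ρ = 0`. -/
lemma mulMap_graphPush (h : DifferentiableAt ℝ ρ z) (V : ℂ ⊗[ℝ] (Fin n → ℂ)) :
    mulMap ((Fin n → ℂ) × ℂ) (graphPush ρ z V) = (mulMap _ V, act ρ z V) := by
  rw [← actMap_apply]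
  induction V using TensorProduct.induction_on with
  | zero => simp only [map_zero, Prod.mk_zero_zero]
  | add x y hx hy => rw [map_add, map_add, hx, hy, map_add, map_add, Prod.mk_add_mk]
  | tmul c u =>
    rw [graphPush, LinearMap.baseChange_tmul, mulMap_tmul, mulMap_tmul]
    change c • fderiv ℝ (graphMap ρ) z u = _
    rw [fderiv_graphMap h]
    rfl

lemma graphPush_injective (h : DifferentiableAt ℝ ρ z) :
    Function.Injective (graphPush ρ z) := by
  have : (LinearMap.baseChange ℂ (LinearMap.fst ℝ (Fin n → ℂ) ℂ)) ∘ₗ graphPush ρ z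
      = LinearMap.id := by
    rw [graphPush, ← LinearMap.baseChange_comp, ← LinearMap.baseChange_id]
    congr 1
    refine LinearMap.ext fun u => ?_
    change (fderiv ℝ (graphMap ρ) z u).1 = u
    rw [fderiv_graphMap h]
  intro x y hxy
  have h2 := congrArg (LinearMap.baseChange ℂ (LinearMap.fst ℝ (Fin n → ℂ) ℂ)) hxy
  rw [← LinearMap.comp_apply, ← LinearMap.comp_apply, this] at h2
  exact h2

lemma graphPush_mem_tangentZeroOne (h : DifferentiableAt ℝ ρ z) (V : ℂ ⊗[ℝ] (Fin n → ℂ)) :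
    graphPush ρ z V ∈ tangentZeroOne ρ z ↔ V ∈ typeZeroOne (Fin n → ℂ) ∧ act ρ z V = 0 := by
  have h1 : graphPush ρ z V ∈ (tangent ρ z).baseChange ℂ := by
    induction V using TensorProduct.induction_on with
    | zero => simp
    | add x y hx hy => rw [map_add]; exact add_mem hx hy
    | tmul c u => exact Submodule.tmul_mem_baseChange_of_mem _ ⟨u, rfl⟩
  rw [tangentZeroOne, Submodule.mem_inf, typeZeroOne_eq_ker, typeZeroOne_eq_ker,
    LinearMap.mem_ker, LinearMap.mem_ker, mulMap_graphPush h, Prod.mk_eq_zero]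
  exact ⟨fun a => a.2, fun a => ⟨h1, a⟩⟩

lemma tangentZeroOne_eq_map (h : DifferentiableAt ℝ ρ z) :
    tangentZeroOne ρ z = Submodule.map (graphPush ρ z)
      (typeZeroOne (Fin n → ℂ) ⊓ LinearMap.ker (actMap ρ z)) := by
  ext W
  constructor
  · intro hW
    have h1 : W ∈ LinearMap.range (graphPush ρ z) := by
      have : (tangent ρ z).baseChange ℂ ≤ LinearMap.range (graphPush ρ z) := by
        rw [Submodule.baseChange_eq_span, Submodule.span_le]
        rintro _ ⟨_, ⟨u, rfl⟩, rfl⟩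
        exact ⟨1 ⊗ₜ u, rfl⟩
      exact this hW.1
    obtain ⟨V, rfl⟩ := h1
    exact ⟨V, (graphPush_mem_tangentZeroOne h V).1 hW, rfl⟩
  · rintro ⟨V, hV, rfl⟩
    exact (graphPush_mem_tangentZeroOne h V).2 hV

lemma finrank_tangentZeroOne (h : DifferentiableAt ℝ ρ z) :
    finrank ℂ (tangentZeroOne ρ z) =
      finrank ℂ (LinearMap.ker ((actMap ρ z).domRestrict (typeZeroOne (Fin n → ℂ)))) := by
  rw [tangentZeroOne_eq_map h]
  rw [← (Submodule.equivMapOfInjective _ (graphPush_injective h) _).finrank_eq,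
    LinearMap.ker_domRestrict]
  have := (Submodule.equivSubtypeMap (typeZeroOne (Fin n → ℂ))
    (Submodule.comap (typeZeroOne (Fin n → ℂ)).subtype (LinearMap.ker (actMap ρ z)))).finrank_eq
  rw [Submodule.map_comap_subtype] at this
  exact this.symm

/-- `T^{0,1}` is the kernel of the functional `V ↦ V ρ` on the `n`-dimensional space of (0,1)
vectors, so its dimension is `n` or `n - 1` according to whether `∂̄ρ` vanishes. -/
lemma finrank_tangentZeroOne_of_forall (h : DifferentiableAt ℝ ρ z)
    (h0 : ∀ u, act ρ z (delBar u) = 0) : finrank ℂ (tangentZeroOne ρ z) = n := by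
  have : (actMap ρ z).domRestrict (typeZeroOne (Fin n → ℂ)) = 0 := by
    have hle : typeZeroOne (Fin n → ℂ) ≤ LinearMap.ker (actMap ρ z) := by
      rw [typeZeroOne, Submodule.span_le]
      rintro _ ⟨u, rfl⟩
      exact h0 u
    ext V
    exact hle V.2
  rw [finrank_tangentZeroOne h, this, LinearMap.ker_zero, finrank_top, finrank_typeZeroOne]
  simp

lemma finrank_tangentZeroOne_of_ne (h : DifferentiableAt ℝ ρ z) {u : Fin n → ℂ}
    (h0 : act ρ z (delBar u) ≠ 0) : finrank ℂ (tangentZeroOne ρ z) + 1 = n := by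
  have hne : (actMap ρ z).domRestrict (typeZeroOne (Fin n → ℂ)) ≠ 0 := by
    intro h'
    exact h0 (DFunLike.congr_fun h' ⟨delBar u, delBar_mem u⟩)
  have := Module.Dual.finrank_ker_add_one_of_ne_zero hne
  rw [finrank_tangentZeroOne h, this, finrank_typeZeroOne]
  simp

end TangentZeroOne

/-! ### Formal partial derivatives of polynomials. -/

section PartialDerivatives

open MvPolynomial

variable {σ : Type*} {K : Type*} [Field K]

lemma totalDegree_pderiv_lt {i : σ} {f : MvPolynomial σ K} (h : pderiv i f ≠ 0) :
    (pderiv i f).totalDegree < f.totalDegree := by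
  classical
  rw [totalDegree, Finset.sup_lt_iff]
  · intro m hm
    rw [mem_support_iff, coeff_pderiv] at hm
    have := le_totalDegree (mem_support_iff.2 (left_ne_zero_of_mul hm))
    rw [Finsupp.sum_add_index' (by simp) (by simp), Finsupp.sum_single_index rfl] at this
    exact this
  · rw [bot_eq_zero, Nat.pos_iff_ne_zero]
    intro h0
    rw [totalDegree_eq_zero_iff_eq_C] at h0
    rw [h0, pderiv_C] at h
    exact h rfl

lemma pderiv_comm (i j : σ) (f : MvPolynomial σ K) :
    pderiv i (pderiv j f) = pderiv j (pderiv i f) := by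
  classical
  ext m
  simp only [coeff_pderiv]
  by_cases h : i = j
  · rw [h]
  · rw [add_right_comm]
    simp [Finsupp.single_eq_of_ne (Ne.symm h), Finsupp.single_eq_of_ne h]
    ring

lemma notMem_vars_of_pderiv_eq_zero [CharZero K] {i : σ} {f : MvPolynomial σ K}
    (h : pderiv i f = 0) : i ∉ f.vars := by
  classical
  intro hi
  obtain ⟨m, hm, him⟩ := (mem_vars_iff_mem_support i).1 hi
  have hle : Finsupp.single i 1 ≤ m := by
    rw [Finsupp.single_le_iff]
    exact Nat.one_le_iff_ne_zero.2 (Finsupp.mem_support_iff.1 him)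
  have h1 := congrArg (coeff (m - Finsupp.single i 1)) h
  rw [coeff_pderiv, tsub_add_cancel_of_le hle, coeff_zero] at h1
  rcases mul_eq_zero.1 h1 with h2 | h2
  · exact mem_support_iff.1 hm h2
  · exact Nat.cast_add_one_ne_zero _ h2

lemma pderiv_surjective [CharZero K] (i : σ) :
    Function.Surjective (pderiv i : MvPolynomial σ K → MvPolynomial σ K) := by
  intro G
  induction G using MvPolynomial.induction_on' with
  | add p q hp hq =>
    obtain ⟨P, rfl⟩ := hp
    obtain ⟨Q, rfl⟩ := hq
    exact ⟨P + Q, map_add _ _ _⟩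
  | monomial m c =>
    refine ⟨monomial (m + Finsupp.single i 1) (c / (m i + 1)), ?_⟩
    rw [pderiv_monomial, add_tsub_cancel_right]
    congr 1
    have : (m i + 1 : K) ≠ 0 := Nat.cast_add_one_ne_zero _
    simp [this]

end PartialDerivatives

/-! ### Polynomials in z and z̄ as functions. -/

section Evaluation

open MvPolynomial

variable {n : ℕ}

/-- In the real coordinates `x, y` the polynomial vanishes at all real points, hence is zero because
`ℝ` is infinite; the passage from `(z, z̄)` to `(x, y)` is an invertible linear substitution. -/
lemma evalBar_injective :
    Function.Injective (evalBar : MvPolynomial (Fin n ⊕ Fin n) ℂ → (Fin n → ℂ) → ℂ) := by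
  intro f g hfg
  rw [← sub_eq_zero]
  have hf : ∀ z, evalBar (f - g) z = 0 := by
    intro z
    rw [evalBar, map_sub, sub_eq_zero]
    exact congrFun hfg z
  set h := f - g
  -- substitute `z = x + iy`, `z̄ = x - iy`
  let s : Fin n ⊕ Fin n → MvPolynomial (Fin n ⊕ Fin n) ℂ :=
    Sum.elim (fun k => X (.inl k) + C I * X (.inr k)) (fun k => X (.inl k) - C I * X (.inr k))
  have hs : bind₁ s h = 0 := by
    refine funext_set (fun _ => Set.range ((↑) : ℝ → ℂ))
      (fun _ => Set.infinite_range_of_injective ofReal_injective) fun x hx => ?_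
    choose y hy using fun i => hx i (Set.mem_univ i)
    rw [map_zero, ← hf fun k => x (.inl k) + I * x (.inr k), evalBar, eval, eval₂Hom_bind₁]
    congr 2
    funext i
    rcases i with k | k
    · simp [s]
    · simp [s, ← hy, sub_eq_add_neg]
  -- The inverse substitution: `x = (z + z̄)/2`, `y = -i (z - z̄)/2`.
  let t : Fin n ⊕ Fin n → MvPolynomial (Fin n ⊕ Fin n) ℂ :=
    Sum.elim (fun k => C (1 / 2) * (X (.inl k) + X (.inr k)))
      (fun k => C (1 / 2) * C (-I) * (X (.inl k) - X (.inr k)))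
  have hts : (bind₁ t).comp (bind₁ s) = AlgHom.id ℂ _ := by
    ext1 i
    have h2 : (C (1 / 2) : MvPolynomial (Fin n ⊕ Fin n) ℂ) + C (1 / 2) = 1 := by
      rw [← C_add, ← C_1]; norm_num
    have hI : (C I * C (-I) : MvPolynomial (Fin n ⊕ Fin n) ℂ) = 1 := by
      rw [← C_mul, mul_neg, I_mul_I, neg_neg, C_1]
    rcases i with k | k
    · simp only [s, t, AlgHom.comp_apply, bind₁_X_right, Sum.elim_inl, Sum.elim_inr, map_add,
        map_mul, bind₁_C_right, AlgHom.id_apply]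
      linear_combination C (1 / 2) * (X (.inl k) - X (.inr k)) * hI + X (.inl k) * h2
    · simp only [s, t, AlgHom.comp_apply, bind₁_X_right, Sum.elim_inl, Sum.elim_inr, map_sub,
        map_mul, bind₁_C_right, AlgHom.id_apply]
      linear_combination C (1 / 2) * (X (.inr k) - X (.inl k)) * hI + X (.inr k) * h2
  have := DFunLike.congr_fun hts h
  rw [AlgHom.comp_apply, hs, map_zero] at this
  exact this.symm

/-- Differentiability is carried along because the product rule in the induction needs it. The
factor `conj (u k)` reflects that `delBar` is antilinear in `u`. -/
lemma act_evalBar (f : MvPolynomial (Fin n ⊕ Fin n) ℂ) (z : Fin n → ℂ) :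
    DifferentiableAt ℝ (evalBar f) z ∧ ∀ u, act (evalBar f) z (delBar u) =
      ∑ k, conj (u k) * evalBar (pderiv (.inr k) f) z := by
  induction f using MvPolynomial.induction_on with
  | C a =>
    have : evalBar (C a : MvPolynomial (Fin n ⊕ Fin n) ℂ) = fun _ => a := by
      funext z; simp [evalBar]
    rw [this]
    refine ⟨differentiableAt_const _, fun u => ?_⟩
    simp [act_delBar, evalBar]
  | add p q hp hq =>
    have : evalBar (p + q) = evalBar p + evalBar q := by
      funext z; simp [evalBar]
    rw [this]
    refine ⟨hp.1.add hq.1, fun u => ?_⟩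
    have e : ∀ k, evalBar (pderiv (.inr k) (p + q)) z =
      evalBar (pderiv (.inr k) p) z + evalBar (pderiv (.inr k) q) z := fun k => by simp [evalBar]
    simp only [e, mul_add, Finset.sum_add_distrib, ← hp.2, ← hq.2, act_delBar,
      fderiv_add hp.1 hq.1, add_apply]
    ring
  | mul_X p i hp =>
    have hX : DifferentiableAt ℝ (fun z : Fin n → ℂ => Sum.elim z (fun k => conj (z k)) i) z ∧
        ∀ u, act (fun z : Fin n → ℂ => Sum.elim z (fun k => conj (z k)) i) z (delBar u) =
          ∑ k, conj (u k) * evalBar (pderiv (.inr k) (X i)) z := by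
      rcases i with j | j
      · have h1 : HasFDerivAt (fun z : Fin n → ℂ => z j)
          (ContinuousLinearMap.proj j : (Fin n → ℂ) →L[ℝ] ℂ) z := hasFDerivAt_apply j z
        refine ⟨h1.differentiableAt, fun u => ?_⟩
        change act (fun z : Fin n → ℂ => z j) z (delBar u) = _
        rw [act_delBar, h1.fderiv]
        simp [evalBar, ← mul_assoc]
      · have h1 : HasFDerivAt (fun z : Fin n → ℂ => conj (z j))
          ((conjCLE : ℂ →L[ℝ] ℂ).comp (ContinuousLinearMap.proj j : (Fin n → ℂ) →L[ℝ] ℂ)) z :=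
          (conjCLE : ℂ →L[ℝ] ℂ).hasFDerivAt.comp z (hasFDerivAt_apply j z)
        refine ⟨h1.differentiableAt, fun u => ?_⟩
        change act (fun z : Fin n → ℂ => conj (z j)) z (delBar u) = _
        rw [act_delBar, h1.fderiv, Finset.sum_eq_single j]
        · simp [evalBar]
          ring_nf
          simp
          ring
        · intro k _ hk
          simp [evalBar, Ne.symm hk]
        · simp
    have : evalBar (p * X i) = evalBar p * fun z => Sum.elim z (fun k => conj (z k)) i := by
      funext z; simp [evalBar]
    rw [this]
    refine ⟨hp.1.mul hX.1, fun u => ?_⟩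
    have e : ∀ k, evalBar (pderiv (.inr k) (p * X i)) z =
      evalBar p z * evalBar (pderiv (.inr k) (X i)) z +
        evalBar (pderiv (.inr k) p) z * Sum.elim z (fun k => conj (z k)) i := fun k => by
      rw [pderiv_mul]; simp [evalBar]; ring
    have e2 : act (evalBar p * fun z => Sum.elim z (fun k => conj (z k)) i) z (delBar u) =
        evalBar p z * act (fun z : Fin n → ℂ => Sum.elim z (fun k => conj (z k)) i) z (delBar u) +
        Sum.elim z (fun k => conj (z k)) i * act (evalBar p) z (delBar u) := by
      simp only [act_delBar, fderiv_mul hp.1 hX.1, add_apply,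
        smul_apply, smul_eq_mul]
      ring
    rw [e2, hp.2, hX.2, Finset.mul_sum, Finset.mul_sum, ← Finset.sum_add_distrib]
    refine Finset.sum_congr rfl fun k _ => ?_
    rw [e]
    ring

end Evaluation

/-! ### The polynomial Q and its z̄-gradient. -/

section QuadricPolynomial

open MvPolynomial

variable {n : ℕ} (A B C₀ : Matrix (Fin n) (Fin n) ℂ)

/-- The polynomial `Q(z, z̄)`. -/
noncomputable def quadricPoly : MvPolynomial (Fin n ⊕ Fin n) ℂ :=
  ∑ i, ∑ j, (C (A i j) * X (.inr i) * X (.inl j) + C (conj (B i j)) * X (.inr i) * X (.inr j) +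
    C (C₀ i j) * X (.inl i) * X (.inl j))

/-- The coefficients of the linear form `∂Q/∂z̄ₖ`. -/
noncomputable def barGradCoeff (k : Fin n) : Fin n ⊕ Fin n →₀ ℂ :=
  Finsupp.equivFunOnFinite.symm (Sum.elim (fun j => A k j) fun j => 2 * conj (B k j))

/-- The linear form `∂Q/∂z̄ₖ`. -/
noncomputable def barGrad (k : Fin n) : MvPolynomial (Fin n ⊕ Fin n) ℂ :=
  sumSMulX (barGradCoeff A B k)

lemma evalBar_quadricPoly (z : Fin n → ℂ) :
    evalBar (quadricPoly A B C₀) z = quadric A B C₀ z := by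
  simp only [evalBar, quadricPoly, map_sum, map_add, map_mul, eval_C, eval_X, Sum.elim_inl,
    Sum.elim_inr, quadric, dotProduct, Matrix.mulVec, Finset.mul_sum, Finset.sum_add_distrib,
    Pi.star_apply, starRingEnd_apply, map_sum, map_mul]
  congr 1
  · congr 1
    all_goals exact Finset.sum_congr rfl fun i _ => Finset.sum_congr rfl fun j _ => by ring
  · exact Finset.sum_congr rfl fun i _ => Finset.sum_congr rfl fun j _ => by ring

lemma barGrad_eq_sum (k : Fin n) : barGrad A B k =
    ∑ j, (C (A k j) * X (.inl j) + C (2 * conj (B k j)) * X (.inr j)) := by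
  rw [barGrad, sumSMulX, Finsupp.linearCombination_apply, Finsupp.sum_fintype _ _ (by simp),
    Fintype.sum_sum_type, Finset.sum_add_distrib]
  simp [barGradCoeff, smul_eq_C_mul]

variable {B} in
lemma pderiv_quadricPoly (hB : B.IsSymm) (k : Fin n) :
    pderiv (.inr k) (quadricPoly A B C₀) = barGrad A B k := by
  rw [barGrad_eq_sum]
  have hs : ∀ i j, B i j = B j i := fun i j => hB.apply j i
  simp only [quadricPoly, map_sum, map_add, pderiv_mul, pderiv_C, pderiv_X, zero_mul, zero_add,
    Finset.sum_add_distrib, Pi.single_apply, Sum.inr.injEq, reduceCtorEq, if_false, mul_zero,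
    add_zero, mul_ite, ite_mul, mul_one, Finset.sum_ite_eq', Finset.sum_const_zero,
    Finset.mem_univ, if_true]
  rw [Finset.sum_comm (f := fun i j => if i = k then C (A i j) * X (Sum.inl j) else 0)]
  rw [Finset.sum_comm (f := fun i j => if i = k then C (conj (B i j)) * X (Sum.inr j) else 0)]
  simp only [Finset.sum_ite_eq', Finset.mem_univ, if_true]
  congr 1
  rw [← Finset.sum_add_distrib]
  refine Finset.sum_congr rfl fun j _ => ?_
  rw [hs j k, two_mul, C_add]
  ring

lemma isHomogeneous_quadricPoly : (quadricPoly A B C₀).IsHomogeneous 2 := by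
  refine IsHomogeneous.sum _ _ _ fun i _ => IsHomogeneous.sum _ _ _ fun j _ => ?_
  have h : ∀ (a : ℂ) (r s : Fin n ⊕ Fin n),
      (C a * X r * X s : MvPolynomial (Fin n ⊕ Fin n) ℂ).IsHomogeneous 2 := fun a r s => by
    simpa using ((isHomogeneous_C _ a).mul (isHomogeneous_X ℂ r)).mul (isHomogeneous_X ℂ s)
  exact ((h _ _ _).add (h _ _ _)).add (h _ _ _)

end QuadricPolynomial

/-! ### Divisibility by the linear forms ∂Q/∂z̄ₖ. -/

section Divisibility

open MvPolynomial

variable {n : ℕ} {A B : Matrix (Fin n) (Fin n) ℂ}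

lemma isHomogeneous_barGrad (k : Fin n) : (barGrad A B k).IsHomogeneous 1 := by
  rw [barGrad_eq_sum]
  have h : ∀ (a : ℂ) (r : Fin n ⊕ Fin n),
      (C a * X r : MvPolynomial (Fin n ⊕ Fin n) ℂ).IsHomogeneous 1 := fun a r => by
    simpa using (isHomogeneous_C _ a).mul (isHomogeneous_X ℂ r)
  exact IsHomogeneous.sum _ _ _ fun j _ => (h _ _).add (h _ _)

lemma prime_barGrad {k : Fin n} (hk : barGrad A B k ≠ 0) : Prime (barGrad A B k) := by
  have hc : barGradCoeff A B k ≠ 0 := fun h => hk (by rw [barGrad, h, map_zero])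
  refine (irreducible_sumSMulX _ (Finsupp.support_nonempty_iff.2 hc) fun r hr => ?_).prime
  obtain ⟨i, hi⟩ := Finsupp.ne_iff.1 hc
  exact isUnit_iff_ne_zero.2 fun h0 => hi (zero_dvd_iff.1 (h0 ▸ hr i))

/-- Both forms have degree one, so the quotient is a constant. -/
lemma barGradCoeff_eq_of_dvd {k l : Fin n} (hk : barGrad A B k ≠ 0)
    (h : barGrad A B k ∣ barGrad A B l) :
    ∃ c, ∀ s, barGradCoeff A B l s = c * barGradCoeff A B k s := by
  by_cases hl : barGrad A B l = 0
  · refine ⟨0, fun s => ?_⟩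
    rw [zero_mul, ← coeff_sumSMulX, ← barGrad, hl, coeff_zero]
  obtain ⟨g, hg⟩ := h
  have hg0 : g ≠ 0 := fun h0 => hl (by rw [hg, h0, mul_zero])
  have hdeg := totalDegree_mul_of_isDomain hk hg0
  rw [← hg, (isHomogeneous_barGrad l).totalDegree hl, (isHomogeneous_barGrad k).totalDegree hk,
    left_eq_add, totalDegree_eq_zero_iff_eq_C] at hdeg
  refine ⟨coeff 0 g, fun s => ?_⟩
  rw [← coeff_sumSMulX, ← coeff_sumSMulX, ← barGrad, ← barGrad, hg, hdeg, mul_comm, coeff_C_mul]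
  simp

/-- The columns of `[A*; B]` are the conjugated coefficient vectors, up to the factor 2 on the `B`
half; proportional columns make the matrix an outer product. -/
lemma rank_le_one_of_proportional (hB : B.IsSymm) (k : Fin n)
    (h : ∀ l, ∃ c, ∀ s, barGradCoeff A B l s = c * barGradCoeff A B k s) :
    (Matrix.fromRows A.conjTranspose B).rank ≤ 1 := by
  choose c hc using h
  have : Matrix.fromRows A.conjTranspose B = Matrix.vecMulVec
      (Sum.elim (fun j => conj (A k j)) fun j => B k j) (fun l => conj (c l)) := by
    ext s l
    rcases s with j | j
    · have := congrArg conj (hc l (.inl j))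
      simp only [barGradCoeff, Finsupp.equivFunOnFinite_symm_apply_apply, Sum.elim_inl,
        map_mul] at this
      simp only [Matrix.fromRows_apply_inl, Matrix.conjTranspose_apply, Matrix.vecMulVec_apply,
        Sum.elim_inl, ← starRingEnd_apply]
      rw [this, mul_comm]
    · have := congrArg conj (hc l (.inr j))
      simp only [barGradCoeff, Finsupp.equivFunOnFinite_symm_apply_apply, Sum.elim_inr,
        map_mul, conj_conj, map_ofNat] at this
      simp only [Matrix.fromRows_apply_inr, Matrix.vecMulVec_apply, Sum.elim_inr]
      rw [← hB.apply]
      linear_combination this / 2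
  rw [this]
  exact Matrix.rank_vecMulVec_le _ _

lemma exists_barGrad_ne_zero (hr : 2 ≤ (Matrix.fromRows A.conjTranspose B).rank)
    (hB : B.IsSymm) : ∃ k, barGrad A B k ≠ 0 := by
  by_contra! h
  have h0 : ∀ k s, barGradCoeff A B k s = 0 := fun k s => by
    rw [← coeff_sumSMulX, ← barGrad, h, coeff_zero]
  rcases isEmpty_or_nonempty (Fin n) with hn | ⟨⟨k⟩⟩
  · have := Matrix.rank_le_card_width (Matrix.fromRows A.conjTranspose B)
    rw [Fintype.card_eq_zero] at this
    omega
  · have := rank_le_one_of_proportional hB k fun l => ⟨0, fun s => by rw [h0, h0, mul_zero]⟩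
    omega

/-- A gradient which is pointwise proportional to `∂̄Q` is a polynomial multiple of `∂̄Q`. -/
lemma exists_mul_barGrad (hr : 2 ≤ (Matrix.fromRows A.conjTranspose B).rank) (hB : B.IsSymm)
    {v : Fin n → MvPolynomial (Fin n ⊕ Fin n) ℂ}
    (hv : ∀ k l, v k * barGrad A B l = v l * barGrad A B k) :
    ∃ g, ∀ k, v k = g * barGrad A B k := by
  obtain ⟨k, hk⟩ := exists_barGrad_ne_zero hr hB
  have hdvd : barGrad A B k ∣ v k := by
    -- Otherwise the prime `Qₖ`, which divides `vₗ Qₖ = vₖ Qₗ`, would divide every `Qₗ`, and the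
    -- rank would be at most one.
    by_contra hnd
    have := rank_le_one_of_proportional hB k fun l => by
      refine barGradCoeff_eq_of_dvd hk ?_
      have : barGrad A B k ∣ v k * barGrad A B l := ⟨v l, by rw [hv, mul_comm]⟩
      exact ((prime_barGrad hk).dvd_or_dvd this).resolve_left hnd
    omega
  obtain ⟨g, hg⟩ := hdvd
  refine ⟨g, fun l => mul_right_cancel₀ hk ?_⟩
  rw [← hv, hg]
  ring

end Divisibility

/-! ### The substitution w = q(z, z̄): injectivity and degrees. -/

section Substitution

open MvPolynomial

variable {n : ℕ} (q : MvPolynomial (Fin n ⊕ Fin n) ℂ)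

/-- The substitution `F(z, w) ↦ F(z, q(z, z̄))`. -/
noncomputable def substHom : MvPolynomial (Fin n ⊕ Unit) ℂ →ₐ[ℂ] MvPolynomial (Fin n ⊕ Fin n) ℂ :=
  aeval (Sum.elim (fun k => X (.inl k)) fun _ => q)

lemma evalBar_substHom (F : MvPolynomial (Fin n ⊕ Unit) ℂ) (z : Fin n → ℂ) :
    evalBar (substHom q F) z = evalHol F z (evalBar q z) := by
  rw [evalBar, evalHol, substHom, ← bind₁, eval, eval₂Hom_bind₁]
  congr 2
  funext i
  rcases i with k | k
  · simp
  · rfl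

lemma substHom_rename (f : MvPolynomial (Fin n) ℂ) :
    substHom q (rename Sum.inl f) = rename Sum.inl f := by
  have : (substHom q).comp (rename Sum.inl) = rename Sum.inl := by
    ext1 k
    simp [substHom]
  exact DFunLike.congr_fun this f

lemma pderiv_substHom (k : Fin n) (F : MvPolynomial (Fin n ⊕ Unit) ℂ) :
    pderiv (.inr k) (substHom q F) = substHom q (pderiv (.inr ()) F) * pderiv (.inr k) q := by
  induction F using MvPolynomial.induction_on with
  | C a => simp [substHom]
  | add p q hp hq => simp only [map_add, hp, hq, add_mul]
  | mul_X p i hp =>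
    rw [map_mul, pderiv_mul, hp, pderiv_mul, map_add, map_mul, map_mul]
    rcases i with i | i
    · simp [substHom]; ring
    · simp [substHom]; ring

lemma exists_rename_of_pderiv_eq_zero {τ : Type*} {f : MvPolynomial (Fin n ⊕ τ) ℂ}
    (h : ∀ k, pderiv (.inr k) f = 0) : ∃ g : MvPolynomial (Fin n) ℂ, rename Sum.inl g = f := by
  refine exists_rename_eq_of_vars_subset_range f Sum.inl Sum.inl_injective fun i hi => ?_
  rcases i with k | k
  · exact ⟨k, rfl⟩
  · exact absurd hi (notMem_vars_of_pderiv_eq_zero (h k))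

variable {q} in
-- If `F(z, q) = 0`, the chain rule gives `F_w(z, q) · ∂q/∂z̄ₖ = 0`, so `F_w = 0` by induction on
-- the degree. Then `F` involves `z` only, and there the substitution is a renaming.
lemma substHom_injective {k : Fin n} (hk : pderiv (.inr k) q ≠ 0) :
    Function.Injective (substHom q) := by
  rw [injective_iff_map_eq_zero]
  intro F
  induction hd : F.totalDegree using Nat.strong_induction_on generalizing F with
  | _ d ih =>
  intro hF
  have h1 : pderiv (.inr ()) F = 0 := by
    by_contra hne
    refine hne (ih _ (hd ▸ totalDegree_pderiv_lt hne) _ rfl ?_)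
    have := pderiv_substHom q k F
    rw [hF, map_zero] at this
    exact (mul_eq_zero.1 this.symm).resolve_right hk
  obtain ⟨g, rfl⟩ := exists_rename_of_pderiv_eq_zero fun _ => h1
  rw [substHom_rename] at hF
  rw [(rename_injective _ Sum.inl_injective) (hF.trans (map_zero _).symm), map_zero]

variable {q}

lemma weight_eq (m : Fin n ⊕ Unit →₀ ℕ) :
    Finsupp.weight (weight (n := n)) m = ∑ i ∈ m.support, weight i * m i := by
  rw [Finsupp.weight_apply, Finsupp.sum]
  exact Finset.sum_congr rfl fun i _ => mul_comm _ _

lemma isHomogeneous_substHom_monomial (hq : q.IsHomogeneous 2) (m : Fin n ⊕ Unit →₀ ℕ) (a : ℂ) :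
    (substHom q (monomial m a)).IsHomogeneous (Finsupp.weight (weight (n := n)) m) := by
  rw [substHom, aeval_monomial, weight_eq, Finsupp.prod, ← zero_add (∑ i ∈ _, _)]
  refine (isHomogeneous_C _ a).mul (IsHomogeneous.prod _ _ _ fun i _ => IsHomogeneous.pow ?_ _)
  rcases i with k | k
  · exact isHomogeneous_X _ _
  · exact hq

/-- Since `w` has weight two and `q` has degree two, a monomial of weight `d` becomes homogeneous of
degree `d`. -/
lemma homogeneousComponent_substHom (hq : q.IsHomogeneous 2) (d : ℕ)
    (F : MvPolynomial (Fin n ⊕ Unit) ℂ) :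
    homogeneousComponent d (substHom q F) =
      substHom q (weightedHomogeneousComponent (weight (n := n)) d F) := by
  induction F using MvPolynomial.induction_on' with
  | add p q hp hq => simp only [map_add, hp, hq]
  | monomial m a =>
    rw [homogeneousComponent_of_mem (isHomogeneous_substHom_monomial hq m a),
      weightedHomogeneousComponent_of_mem (isWeightedHomogeneous_monomial _ m a rfl)]
    split_ifs
    · rfl
    · rw [map_zero]

/-- Injectivity rules out cancellation: a nonzero weighted component has a nonzero image in the same
degree. -/
lemma totalDegree_substHom (hq : q.IsHomogeneous 2) {k : Fin n} (hk : pderiv (.inr k) q ≠ 0)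
    (F : MvPolynomial (Fin n ⊕ Unit) ℂ) :
    weightedTotalDegree (weight (n := n)) F = (substHom q F).totalDegree := by
  apply le_antisymm
  · refine Finset.sup_le fun m hm => ?_
    by_contra! hlt
    have h0 : weightedHomogeneousComponent (weight (n := n)) (Finsupp.weight weight m) F = 0 := by
      apply substHom_injective hk
      rw [← homogeneousComponent_substHom hq, homogeneousComponent_eq_zero _ _ hlt, map_zero]
    have h1 := coeff_weightedHomogeneousComponent (w := weight (n := n)) (Finsupp.weight weight m) F m
    rw [h0, if_pos rfl, coeff_zero] at h1
    exact mem_support_iff.1 hm h1.symm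
  · rw [totalDegree_eq]
    refine Finset.sup_le fun m hm => ?_
    by_contra! hlt
    have h1 := coeff_homogeneousComponent m.degree (substHom q F) m
    rw [homogeneousComponent_substHom hq, weightedHomogeneousComponent_eq_zero, map_zero,
      if_pos rfl, coeff_zero] at h1
    · exact mem_support_iff.1 hm h1.symm
    · simpa [Finsupp.card_toMultiset, Finsupp.degree_eq_sum, Finsupp.sum_fintype] using hlt

lemma isWeightedHomogeneous_of_substHom (hq : q.IsHomogeneous 2) {k : Fin n}
    (hk : pderiv (.inr k) q ≠ 0) {F : MvPolynomial (Fin n ⊕ Unit) ℂ} {d : ℕ}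
    (h : (substHom q F).IsHomogeneous d) : F.IsWeightedHomogeneous (weight (n := n)) d := by
  have : weightedHomogeneousComponent (weight (n := n)) d F = F := by
    apply substHom_injective hk
    rw [← homogeneousComponent_substHom hq, homogeneousComponent_of_mem h, if_pos rfl]
  rw [← this]
  exact weightedHomogeneousComponent_isWeightedHomogeneous _ _

end Substitution

/-! ### Polynomial solutions of ∂̄f ∧ ∂̄Q = 0. -/

section Representation

open MvPolynomial

variable {n : ℕ} {A B : Matrix (Fin n) (Fin n) ℂ}

lemma mem_range_substHom (hr : 2 ≤ (Matrix.fromRows A.conjTranspose B).rank) (hB : B.IsSymm)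
    (C₀ : Matrix (Fin n) (Fin n) ℂ) (f : MvPolynomial (Fin n ⊕ Fin n) ℂ)
    (hf : ∀ k l, pderiv (.inr k) f * barGrad A B l = pderiv (.inr l) f * barGrad A B k) :
    ∃ F, substHom (quadricPoly A B C₀) F = f := by
  induction hd : f.totalDegree using Nat.strong_induction_on generalizing f with
  | _ d ih =>
  have hq := pderiv_quadricPoly A C₀ hB
  obtain ⟨g, hg⟩ := exists_mul_barGrad hr hB hf
  obtain ⟨G, hG⟩ : ∃ G, substHom (quadricPoly A B C₀) G = g := by
    by_cases hg0 : g = 0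
    · exact ⟨0, by rw [hg0, map_zero]⟩
    obtain ⟨k, hk⟩ := exists_barGrad_ne_zero hr hB
    have hne : pderiv (.inr k) f ≠ 0 := by
      rw [hg]
      exact mul_ne_zero hg0 hk
    refine ih _ ?_ g (fun k l => ?_) rfl
    · have h1 := totalDegree_pderiv_lt hne
      rw [hg, totalDegree_mul_of_isDomain hg0 hk] at h1
      omega
    -- In `∂ₖ(g Qₗ) = ∂ₗ(g Qₖ)` the terms containing second derivatives of `Q` cancel, which leaves
    -- the same equations for `g`.
    · have h1 := pderiv_comm (.inr k) (.inr l) f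
      have h2 := pderiv_comm (.inr k) (.inr l) (quadricPoly A B C₀)
      rw [hq, hq] at h2
      rw [hg, hg, pderiv_mul, pderiv_mul, h2] at h1
      exact add_right_cancel h1
  -- With `H_w = G`, the `z̄ₖ`-derivative of `H(z, Q)` is `G(z, Q) Qₖ = g Qₖ`, that of `f`.
  obtain ⟨H, hH⟩ := pderiv_surjective (.inr ()) G
  obtain ⟨r, hr'⟩ := exists_rename_of_pderiv_eq_zero
    (f := f - substHom (quadricPoly A B C₀) H) fun k => by
      rw [map_sub, pderiv_substHom, hH, hG, hq, hg, sub_self]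
  refine ⟨H + rename Sum.inl r, ?_⟩
  rw [map_add, substHom_rename, hr', add_sub_cancel]

end Representation

/-! ### CR points and CR functions on the quadric. -/

section CRFunctions

open MvPolynomial

variable {n : ℕ} {A B : Matrix (Fin n) (Fin n) ℂ} (C₀ : Matrix (Fin n) (Fin n) ℂ)

lemma evalBar_barGrad (k : Fin n) (z : Fin n → ℂ) : evalBar (barGrad A B k) z =
    ∑ j, (A k j * z j + 2 * conj (B k j) * conj (z j)) := by
  simp [barGrad_eq_sum, evalBar]

lemma evalBar_quadricPoly_eq : evalBar (quadricPoly A B C₀) = quadric A B C₀ :=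
  funext (evalBar_quadricPoly A B C₀)

lemma differentiable_quadric : Differentiable ℝ (quadric A B C₀) := by
  rw [← evalBar_quadricPoly_eq]
  exact fun z => (act_evalBar _ z).1

lemma act_quadric (hB : B.IsSymm) (z u : Fin n → ℂ) :
    act (quadric A B C₀) z (delBar u) = ∑ k, conj (u k) * evalBar (barGrad A B k) z := by
  rw [← evalBar_quadricPoly_eq, (act_evalBar _ z).2]
  simp only [pderiv_quadricPoly A C₀ hB]

lemma act_evalBar_single (f : MvPolynomial (Fin n ⊕ Fin n) ℂ) (k : Fin n) (z : Fin n → ℂ) :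
    act (evalBar f) z (delBar (Pi.single k 1)) = evalBar (pderiv (.inr k) f) z := by
  rw [(act_evalBar _ z).2, Finset.sum_eq_single k] <;> simp +contextual

lemma act_quadric_single (hB : B.IsSymm) (k : Fin n) (z : Fin n → ℂ) :
    act (quadric A B C₀) z (delBar (Pi.single k 1)) = evalBar (barGrad A B k) z := by
  rw [← evalBar_quadricPoly_eq, act_evalBar_single, pderiv_quadricPoly A C₀ hB]

lemma isCRPoint_of_ne (hB : B.IsSymm) {z : Fin n → ℂ} {k : Fin n}
    (h : evalBar (barGrad A B k) z ≠ 0) : IsCRPoint (quadric A B C₀) z := by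
  have hc : ContinuousAt (evalBar (barGrad A B k)) z := (act_evalBar _ z).1.continuousAt
  have key : ∀ z', evalBar (barGrad A B k) z' ≠ 0 →
      Module.finrank ℂ (tangentZeroOne (quadric A B C₀) z') + 1 = n := fun z' hz' =>
    finrank_tangentZeroOne_of_ne (differentiable_quadric C₀ z')
      (u := Pi.single k 1) (by rwa [act_quadric_single C₀ hB])
  filter_upwards [hc.eventually_ne h] with z' hz'
  have := key z h
  have := key z' hz'
  omega

/-- At a common zero of the forms the dimension is `n`, but it drops to `n - 1` at the arbitrarily
close points `z + t z₀`, because the forms are real linear. -/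
lemma not_isCRPoint (hB : B.IsSymm) {k : Fin n} {z₀ : Fin n → ℂ}
    (h₀ : evalBar (barGrad A B k) z₀ ≠ 0) {z : Fin n → ℂ}
    (hz : ∀ k, evalBar (barGrad A B k) z = 0) : ¬ IsCRPoint (quadric A B C₀) z := by
  intro h
  have hz0 : Module.finrank ℂ (tangentZeroOne (quadric A B C₀) z) = n :=
    finrank_tangentZeroOne_of_forall (differentiable_quadric C₀ z) fun u => by
      simp [act_quadric C₀ hB, hz]
  have ht : Filter.Tendsto (fun t : ℝ => z + t • z₀) (𝓝[≠] 0) (𝓝 z) := by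
    have : Filter.Tendsto (fun t : ℝ => z + t • z₀) (𝓝 0) (𝓝 (z + (0 : ℝ) • z₀)) :=
      Continuous.tendsto (by fun_prop) 0
    rw [zero_smul, add_zero] at this
    exact this.mono_left nhdsWithin_le_nhds
  obtain ⟨t, ht1, ht2⟩ := ((ht.eventually h).and self_mem_nhdsWithin).exists
  have hne : evalBar (barGrad A B k) (z + t • z₀) ≠ 0 := by
    have : evalBar (barGrad A B k) (z + t • z₀) =
        evalBar (barGrad A B k) z + t * evalBar (barGrad A B k) z₀ := by
      rw [evalBar_barGrad, evalBar_barGrad, evalBar_barGrad, Finset.mul_sum,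
        ← Finset.sum_add_distrib]
      refine Finset.sum_congr rfl fun j _ => ?_
      simp only [Pi.add_apply, Pi.smul_apply, real_smul, map_add, map_mul, conj_ofReal]
      ring
    rw [this, hz, zero_add]
    exact mul_ne_zero (ofReal_ne_zero.2 ht2) h₀
  have := finrank_tangentZeroOne_of_ne (differentiable_quadric C₀ (z + t • z₀))
    (u := Pi.single k 1) (by rwa [act_quadric_single C₀ hB])
  omega

/-- The vector `Qₗ ∂/∂z̄ₖ - Qₖ ∂/∂z̄ₗ` annihilates `Q`, hence is tangent and annihilates `f` at CR
points. Where `Qₖ = Qₗ = 0` both sides vanish. -/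
lemma IsCR.pderiv_mul_barGrad (hB : B.IsSymm) {f : MvPolynomial (Fin n ⊕ Fin n) ℂ}
    (hf : IsCR (quadric A B C₀) (evalBar f)) (k l : Fin n) :
    pderiv (.inr k) f * barGrad A B l = pderiv (.inr l) f * barGrad A B k := by
  apply evalBar_injective
  funext z
  have hmul : ∀ p q : MvPolynomial (Fin n ⊕ Fin n) ℂ, evalBar (p * q) z = evalBar p z * evalBar q z :=
    fun p q => by simp [evalBar]
  rw [hmul, hmul]
  by_cases h : evalBar (barGrad A B l) z = 0 ∧ evalBar (barGrad A B k) z = 0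
  · rw [h.1, h.2, mul_zero, mul_zero]
  have hCR : IsCRPoint (quadric A B C₀) z := by
    by_cases hl : evalBar (barGrad A B l) z = 0
    · exact isCRPoint_of_ne C₀ hB fun hk => h ⟨hl, hk⟩
    · exact isCRPoint_of_ne C₀ hB hl
  have := hf z hCR (evalBar (barGrad A B l) z • delBar (Pi.single k 1) -
    evalBar (barGrad A B k) z • delBar (Pi.single l 1))
    ((graphPush_mem_tangentZeroOne (differentiable_quadric C₀ z) _).2
      ⟨sub_mem (Submodule.smul_mem _ _ (delBar_mem _)) (Submodule.smul_mem _ _ (delBar_mem _)), ?_⟩)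
  · rw [← actMap_apply, map_sub, map_smul, map_smul, actMap_apply, actMap_apply,
      act_evalBar_single, act_evalBar_single, smul_eq_mul, smul_eq_mul] at this
    linear_combination this
  · rw [← actMap_apply, map_sub, map_smul, map_smul, actMap_apply, actMap_apply,
      act_quadric_single C₀ hB, act_quadric_single C₀ hB, smul_eq_mul, smul_eq_mul]
    ring

lemma isCR_of_proportional (hB : B.IsSymm) {k : Fin n} {z₀ : Fin n → ℂ}
    (h₀ : evalBar (barGrad A B k) z₀ ≠ 0) {h : (Fin n → ℂ) → ℂ}
    (hp : ∀ z, ∃ c, ∀ u, act (quadric A B C₀) z (delBar u) = c * act h z (delBar u)) :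
    IsCR (quadric A B C₀) h := by
  intro z hz V hV
  obtain ⟨hV1, hV2⟩ := (graphPush_mem_tangentZeroOne (differentiable_quadric C₀ z) V).1 hV
  obtain ⟨c, hc⟩ := hp z
  have hle : typeZeroOne (Fin n → ℂ) ≤
      LinearMap.ker (actMap (quadric A B C₀) z - c • actMap h z) := by
    rw [typeZeroOne, Submodule.span_le]
    rintro _ ⟨u, rfl⟩
    exact sub_eq_zero.2 (hc u)
  have h1 : act (quadric A B C₀) z V = c * act h z V := sub_eq_zero.1 (hle hV1)
  -- If `c = 0`, then `∂̄Q` vanishes at `z`, which is not a CR point.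
  have hc0 : c ≠ 0 := by
    rintro rfl
    refine not_isCRPoint C₀ hB h₀ (fun j => ?_) hz
    rw [← act_quadric_single C₀ hB, hc, zero_mul]
  rw [hV2] at h1
  exact (mul_eq_zero.1 h1.symm).resolve_left hc0

end CRFunctions

/-! ### Second-order limits of holomorphic functions. -/

section OneVariable

open Filter Metric

lemma tendsto_div_sq_of_deriv_eq_zero {γ : ℂ → ℂ} (hγ : ∀ᶠ t in 𝓝 0, DifferentiableAt ℂ γ t)
    (h0 : γ 0 = 0) (h1 : deriv γ 0 = 0) :
    ∃ L, Tendsto (fun t => γ t / t ^ 2) (𝓝[≠] 0) (𝓝 L) := by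
  have ha : AnalyticAt ℂ γ 0 := analyticAt_iff_eventually_differentiableAt.2 hγ
  obtain ⟨p, hp⟩ := ha
  -- Taking the divided slope at 0 twice is an analytic operation and yields `γ t / t²` away from 0.
  have h2 := hp.has_fpower_series_dslope_fslope.has_fpower_series_dslope_fslope
  refine ⟨_, (h2.continuousAt.tendsto.mono_left nhdsWithin_le_nhds).congr' ?_⟩
  filter_upwards [self_mem_nhdsWithin] with t ht
  have ht : t ≠ 0 := ht
  rw [dslope_of_ne _ ht, slope_def_field, dslope_same, h1, dslope_of_ne _ ht, slope_def_field, h0]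
  field_simp
  ring

/-- A quantitative form of differentiability of a holomorphic function at a point, obtained from the
Schwarz lemma on discs of radius `t`. -/
lemma tendsto_increment_div_sq {F : Type*} [NormedAddCommGroup F] [NormedSpace ℂ F] {g : F → ℂ}
    (hg : ∀ᶠ x in 𝓝 0, DifferentiableAt ℂ g x) (v e : F) :
    Tendsto (fun t : ℝ => (g ((t : ℂ) • v + (t : ℂ) ^ 2 • e) - g ((t : ℂ) • v)) / (t : ℂ) ^ 2)
      (𝓝[>] 0) (𝓝 (fderiv ℂ g 0 e)) := by
  set L := fderiv ℂ g 0
  rw [Metric.tendsto_nhds]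
  intro ε hε
  set M := ‖v‖ + ‖e‖ + 1
  have hM : 0 < M := by positivity
  have hL : HasFDerivAt g L 0 := hg.self_of_nhds.hasFDerivAt
  -- Two errors at points of norm at most `t * M`, each at most `ε / (4 * M)` times `t * M`, add up
  -- to `ε / 2 * t`.
  have hlo := (hL.isLittleO.def (show 0 < ε / (4 * M) by positivity)).and hg
  obtain ⟨δ, hδ, hball⟩ := Metric.eventually_nhds_iff_ball.1 hlo
  have hsmall : ∀ᶠ t : ℝ in 𝓝[>] 0, t < min 1 (δ / M) :=
    nhdsWithin_le_nhds (eventually_lt_nhds (by positivity))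
  filter_upwards [hsmall, self_mem_nhdsWithin] with t ht ht0
  have ht0 : 0 < t := ht0
  have ht1 : t < 1 := ht.trans_le (min_le_left _ _)
  have htδ : t * M < δ := (lt_div_iff₀ hM).1 (ht.trans_le (min_le_right _ _))
  have hx : ∀ s : ℂ, ‖s‖ < t → ‖(t : ℂ) • v + s • e‖ ≤ t * M := by
    intro s hs
    calc ‖(t : ℂ) • v + s • e‖ ≤ ‖(t : ℂ) • v‖ + ‖s • e‖ := norm_add_le _ _
      _ = t * ‖v‖ + ‖s‖ * ‖e‖ := by rw [norm_smul, norm_smul, norm_real, Real.norm_of_nonneg ht0.le]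
      _ ≤ t * ‖v‖ + t * ‖e‖ := by gcongr
      _ ≤ t * M := by simp only [M]; nlinarith
  have hmem : ∀ s : ℂ, ‖s‖ < t → (t : ℂ) • v + s • e ∈ ball (0 : F) δ := fun s hs => by
    rw [mem_ball_zero_iff]
    exact (hx s hs).trans_lt htδ
  -- The oscillation of `k` about `k 0` is at most `ε / 2 * t` on the disc of radius `t`. The
  -- Schwarz lemma improves this to `ε / 2 * t²` at `s = t²`, which differentiability at 0 alone
  -- would not give.
  set k : ℂ → ℂ := fun s => g ((t : ℂ) • v + s • e) - s * L e
  have hk : DifferentiableOn ℂ k (ball 0 t) := by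
    intro s hs
    rw [mem_ball_zero_iff] at hs
    have h1 := (hball _ (hmem s hs)).2
    have h2 : DifferentiableAt ℂ (fun s : ℂ => (t : ℂ) • v + s • e) s := by fun_prop
    exact ((h1.comp s h2).sub (by fun_prop)).differentiableWithinAt
  have hbound : ∀ s : ℂ, ‖s‖ < t →
      ‖g ((t : ℂ) • v + s • e) - g 0 - L ((t : ℂ) • v + s • e)‖ ≤ ε / (4 * M) * (t * M) := by
    intro s hs
    have := (hball _ (hmem s hs)).1
    rw [sub_zero] at this
    exact this.trans (by gcongr; exact hx s hs)
  have hmaps : Set.MapsTo k (ball 0 t) (closedBall (k 0) (ε / 2 * t)) := by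
    intro s hs
    rw [mem_ball_zero_iff] at hs
    rw [mem_closedBall, dist_eq_norm]
    have e1 : k s - k 0 = (g ((t : ℂ) • v + s • e) - g 0 - L ((t : ℂ) • v + s • e)) -
        (g ((t : ℂ) • v + (0 : ℂ) • e) - g 0 - L ((t : ℂ) • v + (0 : ℂ) • e)) := by
      simp only [k, map_add, map_smul, smul_eq_mul]
      ring
    rw [e1]
    refine (norm_sub_le _ _).trans ((add_le_add (hbound s hs) (hbound 0 (by simpa))).trans_eq ?_)
    field_simp
    ring
  have ht2 : ((t : ℂ) ^ 2) ∈ ball (0 : ℂ) t := by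
    rw [mem_ball_zero_iff, norm_pow, norm_real, Real.norm_of_nonneg ht0.le]
    nlinarith
  have hS := Complex.dist_le_div_mul_dist_of_mapsTo_ball hk hmaps ht2
  have htc : (t : ℂ) ≠ 0 := ofReal_ne_zero.2 ht0.ne'
  rw [dist_eq_norm, dist_zero_right, mul_div_cancel_right₀ _ ht0.ne'] at hS
  have e2 : (g ((t : ℂ) • v + (t : ℂ) ^ 2 • e) - g ((t : ℂ) • v)) / (t : ℂ) ^ 2 - L e =
      (k ((t : ℂ) ^ 2) - k 0) / (t : ℂ) ^ 2 := by
    simp only [k, zero_smul, add_zero, zero_mul, sub_zero]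
    field_simp
    ring
  rw [dist_eq_norm, e2, norm_div]
  have hpos : 0 < ‖(t : ℂ) ^ 2‖ := norm_pos_iff.2 (pow_ne_zero 2 htc)
  rw [div_lt_iff₀ hpos]
  nlinarith

end OneVariable

/-! ### Splitting quadrics into sesquilinear, antiholomorphic and holomorphic parts. -/

section Forms

variable {n : ℕ}

/-- The sesquilinear part `z* A z` of a quadric. -/
def hermPart (A : Matrix (Fin n) (Fin n) ℂ) (z : Fin n → ℂ) : ℂ := star z ⬝ᵥ A.mulVec z

/-- The antiholomorphic part of a quadric. -/
def antiPart (B : Matrix (Fin n) (Fin n) ℂ) (z : Fin n → ℂ) : ℂ := conj (z ⬝ᵥ B.mulVec z)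

/-- The holomorphic part `zᵗ C z` of a quadric. -/
def holPart (C₀ : Matrix (Fin n) (Fin n) ℂ) (z : Fin n → ℂ) : ℂ := z ⬝ᵥ C₀.mulVec z

variable {A B C₀ A' B' D' : Matrix (Fin n) (Fin n) ℂ}

lemma quadric_eq_add (z : Fin n → ℂ) :
    quadric A B C₀ z = hermPart A z + antiPart B z + holPart C₀ z := rfl

lemma hermPart_smul (c : ℂ) (z : Fin n → ℂ) :
    hermPart A (c • z) = conj c * c * hermPart A z := by
  simp only [hermPart, star_smul, Matrix.mulVec_smul, smul_dotProduct, dotProduct_smul,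
    smul_eq_mul, starRingEnd_apply]
  ring

lemma antiPart_smul (c : ℂ) (z : Fin n → ℂ) :
    antiPart B (c • z) = conj c ^ 2 * antiPart B z := by
  simp only [antiPart, Matrix.mulVec_smul, smul_dotProduct, dotProduct_smul, smul_eq_mul, map_mul]
  ring

lemma holPart_smul (c : ℂ) (z : Fin n → ℂ) :
    holPart C₀ (c • z) = c ^ 2 * holPart C₀ z := by
  simp only [holPart, Matrix.mulVec_smul, smul_dotProduct, dotProduct_smul, smul_eq_mul]
  ring

lemma quadric_real_smul (t : ℝ) (z : Fin n → ℂ) :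
    quadric A B C₀ ((t : ℂ) • z) = (t : ℂ) ^ 2 * quadric A B C₀ z := by
  simp only [quadric_eq_add, hermPart_smul, antiPart_smul, holPart_smul, conj_ofReal]
  ring

lemma quadric_real_inv_smul (t : ℝ) (z : Fin n → ℂ) :
    quadric A B C₀ ((t : ℂ)⁻¹ • z) = (t : ℂ)⁻¹ ^ 2 * quadric A B C₀ z := by
  rw [← ofReal_inv, quadric_real_smul]

/-- The complex linear part of the differential of `Q` at `p`. -/
noncomputable def holDeriv (A C₀ : Matrix (Fin n) (Fin n) ℂ) (p : Fin n → ℂ) : (Fin n → ℂ) →L[ℂ] ℂ :=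
  LinearMap.toContinuousLinearMap
    (dotProductBilin ℂ ℂ (Matrix.vecMul (star p) A + Matrix.vecMul p C₀ + C₀.mulVec p))

/-- The complex antilinear part of the differential of `Q` at `p`. -/
noncomputable def antiDeriv (A B : Matrix (Fin n) (Fin n) ℂ) (p u : Fin n → ℂ) : ℂ :=
  star u ⬝ᵥ A.mulVec p + conj (p ⬝ᵥ B.mulVec u + u ⬝ᵥ B.mulVec p)

lemma antiDeriv_smul (p u : Fin n → ℂ) (c : ℂ) :
    antiDeriv A B p (c • u) = conj c * antiDeriv A B p u := by
  simp only [antiDeriv, star_smul, Matrix.mulVec_smul, smul_dotProduct, dotProduct_smul,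
    smul_eq_mul, map_add, map_mul, ← starRingEnd_apply (R := ℂ)]
  ring

lemma quadric_add (p u : Fin n → ℂ) : quadric A B C₀ (p + u) =
    quadric A B C₀ p + holDeriv A C₀ p u + antiDeriv A B p u + quadric A B C₀ u := by
  have h : holDeriv A C₀ p u = star p ⬝ᵥ A.mulVec u + p ⬝ᵥ C₀.mulVec u + u ⬝ᵥ C₀.mulVec p := by
    change (Matrix.vecMul (star p) A + Matrix.vecMul p C₀ + C₀.mulVec p) ⬝ᵥ u = _
    rw [add_dotProduct, add_dotProduct, Matrix.dotProduct_mulVec, Matrix.dotProduct_mulVec,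
      dotProduct_comm u]
  rw [h]
  simp only [quadric, antiDeriv, star_add, Matrix.mulVec_add, add_dotProduct, dotProduct_add,
    map_add]
  ring

/-- The nonholomorphic parts of two quadrics agree up to a factor and a linear change of the
coordinates `z`. -/
def LinearlyEquivalent (A B A' B' : Matrix (Fin n) (Fin n) ℂ) : Prop :=
  ∃ (T : (Fin n → ℂ) ≃ₗ[ℂ] (Fin n → ℂ)) (c : ℂ), c ≠ 0 ∧ ∀ z,
    hermPart A' (T z) = c * hermPart A z ∧ antiPart B' (T z) = c * antiPart B z

lemma LinearlyEquivalent.symm (h : LinearlyEquivalent A B A' B') :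
    LinearlyEquivalent A' B' A B := by
  obtain ⟨T, c, hc, h⟩ := h
  refine ⟨T.symm, c⁻¹, inv_ne_zero hc, fun z => ?_⟩
  have := h (T.symm z)
  rw [T.apply_symm_apply] at this
  rw [this.1, this.2]
  exact ⟨by field_simp, by field_simp⟩

/-- If the difference of two quadrics is complex homogeneous of degree two, then their
nonholomorphic parts agree. -/
lemma parts_eq_of_homogeneous (T : (Fin n → ℂ) →ₗ[ℂ] (Fin n → ℂ)) (c : ℂ)
    (h : ∀ (a : ℂ) z, a ≠ 0 → quadric A' B' D' (T (a • z)) - c * quadric A B C₀ (a • z) =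
      a ^ 2 * (quadric A' B' D' (T z) - c * quadric A B C₀ z)) (z : Fin n → ℂ) :
    hermPart A' (T z) = c * hermPart A z ∧ antiPart B' (T z) = c * antiPart B z := by
  -- For `a = i` only the sesquilinear part scales differently from `a² = -1`. For `a = 1 + i` the
  -- antiholomorphic part scales by `-2i` against `a² = 2i`.
  have hI := h I z I_ne_zero
  have h1 := h (1 + I) z (fun h => by simpa using congrArg re h)
  simp only [map_smul, quadric_eq_add, hermPart_smul, antiPart_smul, holPart_smul, map_add,
    map_one, conj_I] at hI h1
  have e1 : hermPart A' (T z) = c * hermPart A z := by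
    linear_combination hI / 2 + (hermPart A' (T z) - c * hermPart A z) * I_mul_I
  refine ⟨e1, ?_⟩
  rw [e1] at h1
  have e2 : 4 * I * (antiPart B' (T z) - c * antiPart B z) = 0 := by
    linear_combination -h1
  exact sub_eq_zero.1 ((mul_eq_zero.1 e2).resolve_left (by simp))

end Forms

/-! ### Biholomorphic equivalence implies linear equivalence. -/

section Germs

open Filter

variable {n : ℕ} {A B C₀ A' B' D' : Matrix (Fin n) (Fin n) ℂ}

/-- The curve `t ↦ (t v, t² Q(v))` on a quadric. -/
lemma curve_mem_graph (t : ℝ) (v : Fin n → ℂ) :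
    (t : ℂ) • (v, (0 : ℂ)) + (t : ℂ) ^ 2 • ((0 : Fin n → ℂ), quadric A B C₀ v) ∈
      graph (quadric A B C₀) := by
  simp only [graph, Set.mem_ofPred_eq, Prod.smul_mk, Prod.mk_add_mk, smul_zero, add_zero,
    smul_eq_mul, quadric_real_smul, mul_zero, zero_add]

lemma hasDerivAt_curve {F : Type*} [NormedAddCommGroup F] [NormedSpace ℂ F] [NormedSpace ℝ F]
    [IsScalarTower ℝ ℂ F] (v e : F) :
    HasDerivAt (fun t : ℝ => (t : ℂ) • v + (t : ℂ) ^ 2 • e) v 0 := by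
  have h1 : HasDerivAt (fun t : ℝ => (t : ℂ)) 1 0 := ofRealCLM.hasDerivAt
  have h2 := (h1.smul_const v).add ((h1.pow 2).smul_const e)
  exact h2.congr_deriv (by simp)

/-- The map `φ` is tested on the real curves `t ↦ (t v, t² Q v)` in the quadric. First order shows
that the antilinear differential of `Q'` vanishes at `p`. Second order expresses `Q' (T v) - μ Q v`
as a Taylor coefficient of a holomorphic function, so it is complex homogeneous of degree two in
`v`. The image of 0 may be any point of the target. -/
theorem linearlyEquivalent_of_germ {φ : (Fin n → ℂ) × ℂ → (Fin n → ℂ) × ℂ}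
    (hd : ∀ᶠ x in 𝓝 0, DifferentiableAt ℂ φ x) (hbij : Function.Bijective (fderiv ℂ φ 0))
    (hM : ∀ᶠ x in 𝓝 0, x ∈ graph (quadric A B C₀) → φ x ∈ graph (quadric A' B' D')) :
    LinearlyEquivalent A B A' B' := by
  set Q := quadric A B C₀
  set Q' := quadric A' B' D'
  set D := fderiv ℂ φ 0
  have hD : HasFDerivAt φ D 0 := hd.self_of_nhds.hasFDerivAt
  set p := (φ 0).1
  have hQ0 : Q 0 = 0 := by simp [Q, quadric]
  have hQ'c : Continuous Q' := (differentiable_quadric D').continuous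
  have hφ0 : (φ 0).2 = Q' p := hM.self_of_nhds (by simpa [graph] using hQ0.symm)
  set ℓ := holDeriv A' D' p
  set c : (Fin n → ℂ) → ℝ → (Fin n → ℂ) × ℂ := fun v t =>
    (t : ℂ) • (v, (0 : ℂ)) + (t : ℂ) ^ 2 • ((0 : Fin n → ℂ), Q v)
  have hc0 : ∀ v, c v 0 = 0 := fun v => by simp [c]
  have hcd : ∀ v, HasDerivAt (c v) (v, 0) 0 := fun v => hasDerivAt_curve _ _
  have hcM : ∀ v, ∀ᶠ t in 𝓝[>] (0 : ℝ), (φ (c v t)).2 = Q' (φ (c v t)).1 := by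
    intro v
    have hlim : Tendsto (c v) (𝓝[>] 0) (𝓝 0) := by
      have := (hcd v).continuousAt.tendsto
      rw [hc0] at this
      exact this.mono_left nhdsWithin_le_nhds
    filter_upwards [hlim.eventually hM] with t ht
    exact ht (curve_mem_graph t v)
  have hslope : ∀ v, Tendsto (fun t : ℝ => (t : ℂ)⁻¹ • (φ (c v t) - φ 0)) (𝓝[>] 0)
      (𝓝 (D (v, 0))) := by
    intro v
    have h1 : HasFDerivAt φ (D.restrictScalars ℝ) (c v 0) := by
      rw [hc0]; exact hD.restrictScalars ℝ
    have h2 := (h1.comp_hasDerivAt (0 : ℝ) (hcd v)).tendsto_slope_zero_right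
    refine h2.congr fun t => ?_
    simp only [Function.comp_apply, zero_add, hc0]
    rw [← ofReal_inv]
    exact (algebraMap_smul ℂ (t⁻¹) _).symm
  set T : (Fin n → ℂ) →ₗ[ℂ] (Fin n → ℂ) :=
    LinearMap.fst ℂ _ ℂ ∘ₗ (D : _ →ₗ[ℂ] _) ∘ₗ LinearMap.inl ℂ _ ℂ
  have hT : ∀ v, T v = (D (v, 0)).1 := fun v => rfl
  have hslope1 : ∀ v, Tendsto (fun t : ℝ => (t : ℂ)⁻¹ • ((φ (c v t)).1 - p)) (𝓝[>] 0)
      (𝓝 (T v)) := fun v => (continuous_fst.tendsto _).comp (hslope v)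
  have hnz : ∀ᶠ t : ℝ in 𝓝[>] 0, (t : ℂ) ≠ 0 := by
    filter_upwards [self_mem_nhdsWithin] with t ht
    exact ofReal_ne_zero.2 (ne_of_gt ht)
  have hofReal : Tendsto (fun t : ℝ => (t : ℂ)) (𝓝[>] 0) (𝓝 0) :=
    (continuous_ofReal.tendsto' 0 0 ofReal_zero).mono_left nhdsWithin_le_nhds
  have hac : Continuous (antiDeriv A' B' p) := by
    have : antiDeriv A' B' p = fun u => Q' (p + u) - Q' p - ℓ u - Q' u := by
      funext u
      simp only [Q', ℓ, quadric_add]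
      ring
    rw [this]
    fun_prop
  -- the first order terms
  have hfirst : ∀ v, (D (v, 0)).2 = ℓ (T v) + antiDeriv A' B' p (T v) := by
    intro v
    have h1 : Tendsto (fun t : ℝ => (t : ℂ)⁻¹ • ((φ (c v t)).2 - Q' p)) (𝓝[>] 0)
        (𝓝 (D (v, 0)).2) := by
      rw [← hφ0]
      exact (continuous_snd.tendsto _).comp (hslope v)
    -- After division by `t`, the quadratic remainder is `t` times a convergent expression and tends
    -- to 0.
    have h2 := ((ℓ.continuous.tendsto _).comp (hslope1 v)).add
      ((hac.tendsto _).comp (hslope1 v)) |>.add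
      (hofReal.mul ((hQ'c.tendsto _).comp (hslope1 v)))
    rw [zero_mul, add_zero] at h2
    refine tendsto_nhds_unique h1 (h2.congr' ?_)
    filter_upwards [hcM v, hnz] with t ht htn
    rw [ht]
    have e := quadric_add (A := A') (B := B') (C₀ := D') p ((φ (c v t)).1 - p)
    rw [add_sub_cancel] at e
    simp only [Function.comp_apply, map_smul, antiDeriv_smul, smul_eq_mul, map_inv₀, conj_ofReal]
    simp only [Q', quadric_real_inv_smul, e, ℓ]
    field_simp
    ring
  -- All other terms of `hfirst` are complex linear in `v`, so replacing `v` by `i v` isolates the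
  -- antilinear one.
  have hanti : ∀ v, antiDeriv A' B' p (T v) = 0 := by
    intro v
    have h1 := hfirst (I • v)
    have e : ((I • v, 0) : (Fin n → ℂ) × ℂ) = I • (v, 0) := by simp
    rw [e, map_smul, map_smul, map_smul, Prod.smul_snd, hfirst v, antiDeriv_smul, conj_I,
      smul_eq_mul, smul_eq_mul] at h1
    have : 2 * I * antiDeriv A' B' p (T v) = 0 := by linear_combination h1
    exact (mul_eq_zero.1 this).resolve_left (by simp)
  have hTinj : Function.Injective T := by
    rw [injective_iff_map_eq_zero]
    intro v hv
    have h2 := hfirst v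
    rw [hanti, hv, map_zero, add_zero] at h2
    have h3 : D (v, 0) = 0 := Prod.ext hv h2
    exact congrArg Prod.fst (hbij.1 (h3.trans (map_zero D).symm))
  have hTsurj : Function.Surjective T := LinearMap.injective_iff_surjective.1 hTinj
  have hanti0 : ∀ u, antiDeriv A' B' p u = 0 := fun u => by
    obtain ⟨v, rfl⟩ := hTsurj u
    exact hanti v
  -- normalize the last component
  set g : (Fin n → ℂ) × ℂ → ℂ := fun x => (φ x).2 - Q' p - ℓ ((φ x).1 - p)
  have hgd : ∀ᶠ x in 𝓝 0, DifferentiableAt ℂ g x := by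
    filter_upwards [hd] with x hx
    exact ((hx.snd.sub_const _).sub (ℓ.differentiableAt.comp x (hx.fst.sub_const _)))
  have hg0 : g 0 = 0 := by simp [g, hφ0, p]
  have hgD : ∀ x, fderiv ℂ g 0 x = (D x).2 - ℓ (D x).1 := by
    intro x
    have h1 : HasFDerivAt g ((ContinuousLinearMap.snd ℂ (Fin n → ℂ) ℂ).comp D -
        ℓ.comp ((ContinuousLinearMap.fst ℂ (Fin n → ℂ) ℂ).comp D)) 0 :=
      (hD.snd.sub_const _).sub (ℓ.hasFDerivAt.comp 0 (hD.fst.sub_const _))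
    rw [h1.fderiv]
    rfl
  have hgz : ∀ v, fderiv ℂ g 0 (v, 0) = 0 := fun v => by
    rw [hgD, hfirst, hanti, add_zero, hT, sub_self]
  set μ := fderiv ℂ g 0 (0, 1)
  -- Otherwise `D (0, 1)` would lie in the image of `ℂⁿ × 0` under the injective map `D`.
  have hμ : μ ≠ 0 := by
    intro h0
    obtain ⟨v, hv⟩ := hTsurj (D (0, 1)).1
    have h1 : D (0, 1) = D (v, 0) := by
      refine Prod.ext hv.symm ?_
      rw [hfirst, hanti, add_zero, hv]
      exact sub_eq_zero.1 ((hgD _).symm.trans h0)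
    have := congrArg Prod.snd (hbij.1 h1)
    exact one_ne_zero this
  have hgQ : ∀ v, fderiv ℂ g 0 (0, Q v) = μ * Q v := by
    intro v
    have : ((0, Q v) : (Fin n → ℂ) × ℂ) = Q v • (0, 1) := by simp
    rw [this, map_smul, smul_eq_mul, mul_comm]
  -- the second order terms
  have hsecond : ∀ v, Tendsto (fun t : ℝ => g ((t : ℂ) • (v, 0)) / (t : ℂ) ^ 2) (𝓝[>] 0)
      (𝓝 (Q' (T v) - μ * Q v)) := by
    intro v
    have h1 := tendsto_increment_div_sq hgd (v, 0) (0, Q v)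
    rw [hgQ] at h1
    have h2 := ((hQ'c.tendsto _).comp (hslope1 v)).sub h1
    refine h2.congr' ?_
    filter_upwards [hcM v, hnz] with t ht htn
    have e := quadric_add (A := A') (B := B') (C₀ := D') p ((φ (c v t)).1 - p)
    rw [add_sub_cancel, hanti0, add_zero] at e
    have e2 : g ((t : ℂ) • (v, (0 : ℂ)) + (t : ℂ) ^ 2 • ((0 : Fin n → ℂ), Q v)) =
        Q' ((φ (c v t)).1 - p) := by
      change (φ (c v t)).2 - Q' p - ℓ ((φ (c v t)).1 - p) = _
      rw [ht]
      simp only [Q', e, ℓ]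
      ring
    rw [e2, Function.comp_apply]
    simp only [Q', quadric_real_inv_smul]
    field_simp
    ring
  -- Along the complex line through `(v, 0)` the function `g` vanishes to second order, so the limit
  -- known for `t > 0` holds for complex `t`; rescaling `t` by `a` then gives homogeneity.
  have hhom : ∀ v, Tendsto (fun t : ℂ => g (t • (v, 0)) / t ^ 2) (𝓝[≠] 0)
      (𝓝 (Q' (T v) - μ * Q v)) := by
    intro v
    have hline : ∀ t : ℂ, HasDerivAt (fun t : ℂ => t • ((v, 0) : (Fin n → ℂ) × ℂ)) (v, 0) t :=
      fun t => by simpa using (hasDerivAt_id t).smul_const ((v, 0) : (Fin n → ℂ) × ℂ)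
    have hlim : Tendsto (fun t : ℂ => t • ((v, 0) : (Fin n → ℂ) × ℂ)) (𝓝 0) (𝓝 0) := by
      simpa using (hline 0).continuousAt.tendsto
    obtain ⟨L, hL⟩ := tendsto_div_sq_of_deriv_eq_zero (γ := fun t : ℂ => g (t • (v, 0)))
      (by
        filter_upwards [hlim.eventually hgd] with t ht
        exact ht.comp t (hline t).differentiableAt)
      (by simp only [zero_smul, hg0])
      (by
        have h1 : HasFDerivAt g (fderiv ℂ g 0) ((0 : ℂ) • ((v, 0) : (Fin n → ℂ) × ℂ)) := by
          rw [zero_smul]; exact hgd.self_of_nhds.hasFDerivAt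
        have := (h1.comp_hasDerivAt (0 : ℂ) (hline 0)).deriv
        rw [hgz] at this
        exact this)
    have hsub : Tendsto (fun t : ℝ => (t : ℂ)) (𝓝[>] 0) (𝓝[≠] 0) :=
      tendsto_nhdsWithin_iff.2 ⟨hofReal, hnz⟩
    rwa [tendsto_nhds_unique (hsecond v) (hL.comp hsub)]
  refine ⟨LinearEquiv.ofBijective T ⟨hTinj, hTsurj⟩, μ, hμ,
    parts_eq_of_homogeneous (C₀ := C₀) (D' := D') T μ fun a v ha => ?_⟩
  have hscale : Tendsto (fun t : ℂ => t * a) (𝓝[≠] 0) (𝓝[≠] 0) := by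
    refine tendsto_nhdsWithin_iff.2 ⟨?_, ?_⟩
    · exact ((continuous_mul_const a).tendsto' 0 0 (zero_mul a)).mono_left nhdsWithin_le_nhds
    · filter_upwards [self_mem_nhdsWithin] with t ht
      exact mul_ne_zero ht ha
  refine tendsto_nhds_unique (hhom (a • v))
    ((((hhom v).comp hscale).const_mul (a ^ 2)).congr' ?_)
  filter_upwards [self_mem_nhdsWithin] with t ht
  have ht : t ≠ 0 := ht
  have e : (t * a) • ((v, 0) : (Fin n → ℂ) × ℂ) = t • (a • v, 0) := by
    simp [mul_smul]
  rw [Function.comp_apply, e]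
  field_simp

lemma bijective_fderiv_of_inverse {E : Type*} [NormedAddCommGroup E] [NormedSpace ℂ E]
    {φ ψ : E → E} {x : E} (hφ : DifferentiableAt ℂ φ x) (hψ : DifferentiableAt ℂ ψ (φ x))
    (hl : ∀ᶠ y in 𝓝 x, ψ (φ y) = y) (hr : ∀ᶠ y in 𝓝 (φ x), φ (ψ y) = y) :
    Function.Bijective (fderiv ℂ φ x) := by
  have hx : ψ (φ x) = x := hl.self_of_nhds
  have h1 : (fderiv ℂ ψ (φ x)).comp (fderiv ℂ φ x) = ContinuousLinearMap.id ℂ E :=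
    (hψ.hasFDerivAt.comp x hφ.hasFDerivAt).unique
      ((hasFDerivAt_id x).congr_of_eventuallyEq hl)
  have h2 : (fderiv ℂ φ x).comp (fderiv ℂ ψ (φ x)) = ContinuousLinearMap.id ℂ E := by
    have hφ' : HasFDerivAt φ (fderiv ℂ φ x) (ψ (φ x)) := by rw [hx]; exact hφ.hasFDerivAt
    exact (hφ'.comp (φ x) hψ.hasFDerivAt).unique
      ((hasFDerivAt_id (φ x)).congr_of_eventuallyEq hr)
  exact Function.bijective_iff_has_inverse.2 ⟨fderiv ℂ ψ (φ x),
    fun v => DFunLike.congr_fun h1 v, fun v => DFunLike.congr_fun h2 v⟩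

theorem LocallyBiholomorphic.linearlyEquivalent
    (h : LocallyBiholomorphic (graph (quadric A B C₀)) (graph (quadric A' B' D'))) :
    LinearlyEquivalent A B A' B' := by
  obtain ⟨φ, h0, -, hd, hd', hM⟩ := h
  have hs := φ.open_source.mem_nhds h0
  have ht := φ.open_target.mem_nhds (φ.map_source h0)
  refine linearlyEquivalent_of_germ (φ := φ) (C₀ := C₀) (D' := D') ?_ ?_ ?_
  · filter_upwards [φ.open_source.eventually_mem h0] with x hx
    exact hd.differentiableAt (φ.open_source.mem_nhds hx)
  · refine bijective_fderiv_of_inverse (ψ := φ.symm) (hd.differentiableAt hs)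
      (hd'.differentiableAt ht) ?_ ?_
    · filter_upwards [hs] with y hy using φ.left_inv hy
    · filter_upwards [ht] with y hy using φ.right_inv hy
  · filter_upwards [hs] with x hx using (hM x hx).2

theorem GloballyBiholomorphic.linearlyEquivalent
    (h : GloballyBiholomorphic (graph (quadric A B C₀)) (graph (quadric A' B' D'))) :
    LinearlyEquivalent A B A' B' := by
  obtain ⟨φ, hd, hd', hM⟩ := h
  refine linearlyEquivalent_of_germ (φ := φ) (C₀ := C₀) (D' := D') (.of_forall fun x => hd x)
    (bijective_fderiv_of_inverse (hd 0) (hd' _) (.of_forall φ.symm_apply_apply)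
      (.of_forall φ.apply_symm_apply)) (.of_forall fun x hx => ?_)
  rw [← hM]
  exact ⟨x, hx, rfl⟩

end Germs

/-! ### Invariance of the rank. -/

section RankInvariance

open Matrix

variable {n : ℕ} {A B A' B' : Matrix (Fin n) (Fin n) ℂ}

/-- Polarization: replacing `w` by `i w` separates the two cross terms. -/
lemma eq_zero_of_hermPart {X : Matrix (Fin n) (Fin n) ℂ} (h : ∀ z, hermPart X z = 0) : X = 0 := by
  have key : ∀ z w : Fin n → ℂ, star z ⬝ᵥ X *ᵥ w = 0 := by
    intro z w
    have hp : ∀ w, star z ⬝ᵥ X *ᵥ w + star w ⬝ᵥ X *ᵥ z = 0 := by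
      intro w
      have h1 := h (z + w)
      have h2 := h z
      have h3 := h w
      simp only [hermPart, star_add, mulVec_add, add_dotProduct, dotProduct_add] at h1 h2 h3
      linear_combination h1 - h2 - h3
    have h1 := hp w
    have h2 := hp (I • w)
    simp only [star_smul, mulVec_smul, smul_dotProduct, dotProduct_smul, smul_eq_mul,
      Complex.star_def, conj_I] at h2
    have : 2 * I * (star z ⬝ᵥ X *ᵥ w) = 0 := by linear_combination h2 + I * h1
    exact (mul_eq_zero.1 this).resolve_left (by simp)
  ext i j
  have := key (Pi.single i 1) (Pi.single j 1)
  rwa [← Pi.single_star, star_one, mulVec_single_one, single_one_dotProduct] at this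

lemma eq_zero_of_antiPart {X : Matrix (Fin n) (Fin n) ℂ} (hX : X.IsSymm)
    (h : ∀ z, antiPart X z = 0) : X = 0 := by
  have h0 : ∀ z, z ⬝ᵥ X *ᵥ z = 0 := fun z => by simpa [antiPart] using h z
  have key : ∀ z w : Fin n → ℂ, z ⬝ᵥ X *ᵥ w = 0 := by
    intro z w
    have h1 := h0 (z + w)
    have h2 := h0 z
    have h3 := h0 w
    have h4 : w ⬝ᵥ X *ᵥ z = z ⬝ᵥ X *ᵥ w := by
      rw [dotProduct_mulVec, ← mulVec_transpose, hX.eq, dotProduct_comm]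
    simp only [mulVec_add, add_dotProduct, dotProduct_add] at h1
    linear_combination (h1 - h2 - h3 - h4) / 2
  ext i j
  have := key (Pi.single i 1) (Pi.single j 1)
  rwa [mulVec_single_one, single_one_dotProduct] at this

lemma hermPart_mulVec (S : Matrix (Fin n) (Fin n) ℂ) (z : Fin n → ℂ) :
    hermPart A (S *ᵥ z) = hermPart (Sᴴ * A * S) z := by
  simp only [hermPart, star_mulVec, ← mulVec_mulVec, dotProduct_mulVec, vecMul_vecMul]

lemma antiPart_mulVec (S : Matrix (Fin n) (Fin n) ℂ) (z : Fin n → ℂ) :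
    antiPart B (S *ᵥ z) = antiPart (Sᵀ * B * S) z := by
  simp only [antiPart, ← mulVec_mulVec, dotProduct_mulVec, vecMul_transpose]

/-- With `S` the matrix of `T`, polarization gives `S* A' S = c A` and `Sᵗ B' S = c̄ B`. Hence `[A*;
B]` is a block diagonal matrix times `[A'*; B']` times `S`. -/
lemma LinearlyEquivalent.rank_le (h : LinearlyEquivalent A B A' B') (hB : B.IsSymm)
    (hB' : B'.IsSymm) : (fromRows Aᴴ B).rank ≤ (fromRows A'ᴴ B').rank := by
  obtain ⟨T, c, hc, h⟩ := h
  set S := LinearMap.toMatrix' (T : (Fin n → ℂ) →ₗ[ℂ] (Fin n → ℂ))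
  have hS : ∀ z, T z = S *ᵥ z := fun z => (LinearMap.toMatrix'_mulVec _ z).symm
  have h1 : Sᴴ * A' * S = c • A := by
    rw [← sub_eq_zero]
    refine eq_zero_of_hermPart fun z => ?_
    have := (h z).1
    rw [hS, hermPart_mulVec] at this
    simp only [hermPart, sub_mulVec, dotProduct_sub, smul_mulVec, dotProduct_smul,
      smul_eq_mul] at this ⊢
    rw [this, sub_self]
  have h2 : Sᵀ * B' * S = conj c • B := by
    rw [← sub_eq_zero]
    refine eq_zero_of_antiPart ?_ fun z => ?_
    · rw [IsSymm, transpose_sub, transpose_smul, hB.eq, transpose_mul, transpose_mul,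
        transpose_transpose, hB'.eq, Matrix.mul_assoc]
    have := (h z).2
    rw [hS, antiPart_mulVec] at this
    simp only [antiPart, sub_mulVec, dotProduct_sub, smul_mulVec, dotProduct_smul,
      smul_eq_mul, map_sub, map_mul, conj_conj] at this ⊢
    rw [this, sub_self]
  have h3 : Sᴴ * A'ᴴ * S = conj c • Aᴴ := by
    have := congrArg conjTranspose h1
    rwa [conjTranspose_mul, conjTranspose_mul, conjTranspose_conjTranspose, conjTranspose_smul,
      ← Matrix.mul_assoc, ← starRingEnd_apply] at this
  have hc' : conj c ≠ 0 := (map_ne_zero _).2 hc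
  have h4 : fromRows Aᴴ B =
      ((conj c)⁻¹ • fromBlocks Sᴴ 0 0 Sᵀ) * fromRows A'ᴴ B' * S := by
    rw [Matrix.smul_mul, Matrix.smul_mul, fromBlocks_mul_fromRows, Matrix.zero_mul, Matrix.zero_mul,
      add_zero, zero_add, fromRows_mul, h3, h2]
    ext (i | i) j <;> simp [hc']
  rw [h4]
  exact (rank_mul_le_left _ _).trans (rank_mul_le_right _ _)

end RankInvariance

/-! ### The exceptional quadrics: rank and mutual inequivalence. -/

section ExceptionalQuadrics

open Matrix

variable {n : ℕ}

/-- The sesquilinear part of an exceptional quadric. -/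
def Exceptional.sesq (hn : 2 ≤ n) : Exceptional → Matrix (Fin n) (Fin n) ℂ
  | .one => single ⟨0, by omega⟩ ⟨1, by omega⟩ 1
  | .two => single ⟨0, by omega⟩ ⟨1, by omega⟩ 1
  | .three _ => single ⟨0, by omega⟩ ⟨0, by omega⟩ 1
  | .four => 0

/-- The antiholomorphic part of an exceptional quadric. -/
noncomputable def Exceptional.anti (hn : 2 ≤ n) : Exceptional → Matrix (Fin n) (Fin n) ℂ
  | .one => single ⟨0, by omega⟩ ⟨0, by omega⟩ 1
  | .two => 0
  | .three a => single ⟨0, by omega⟩ ⟨0, by omega⟩ ((a : ℝ) : ℂ)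
  | .four => single ⟨0, by omega⟩ ⟨0, by omega⟩ 1

lemma hermPart_single (i j : Fin n) (z : Fin n → ℂ) :
    hermPart (single i j 1) z = conj (z i) * z j := by
  have h : ∀ x : ℂ, Function.update (0 : Fin n → ℂ) i x = Pi.single i x := fun _ => rfl
  simp [hermPart, single_mulVec, h]

lemma antiPart_single (i : Fin n) (c : ℂ) (z : Fin n → ℂ) :
    antiPart (single i i c) z = conj c * conj (z i) ^ 2 := by
  have h : ∀ x : ℂ, Function.update (0 : Fin n → ℂ) i x = Pi.single i x := fun _ => rfl
  simp [antiPart, single_mulVec, h]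
  ring

lemma hermPart_zero (z : Fin n → ℂ) : hermPart 0 z = 0 := by simp [hermPart]

lemma antiPart_zero (z : Fin n → ℂ) : antiPart 0 z = 0 := by simp [antiPart]

lemma Exceptional.fn_eq_quadric (hn : 2 ≤ n) (e : Exceptional) :
    e.fn hn = quadric (e.sesq hn) (e.anti hn) 0 := by
  funext z
  have h0 : holPart 0 z = 0 := by simp [holPart]
  rw [quadric_eq_add, h0, add_zero]
  cases e <;> simp only [fn, sesq, anti, hermPart_single, antiPart_single, hermPart_zero,
    antiPart_zero, map_one, one_mul, add_zero, zero_add, conj_ofReal, conj_mul', ofReal_pow]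

lemma Exceptional.anti_isSymm (hn : 2 ≤ n) (e : Exceptional) : (e.anti hn).IsSymm := by
  cases e <;> simp [IsSymm, anti]

lemma Exceptional.rank_le_one (hn : 2 ≤ n) (e : Exceptional) :
    (fromRows (e.sesq hn)ᴴ (e.anti hn)).rank ≤ 1 := by
  have : fromRows (e.sesq hn)ᴴ (e.anti hn) =
      vecMulVec (fun s => fromRows (e.sesq hn)ᴴ (e.anti hn) s ⟨0, by omega⟩)
        (Pi.single ⟨0, by omega⟩ 1) := by
    ext s l
    rw [vecMulVec_apply]
    by_cases hl : l = ⟨0, by omega⟩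
    · rw [hl, Pi.single_eq_same, mul_one]
    · rw [Pi.single_eq_of_ne hl, mul_zero]
      rcases s with s | s <;> cases e <;> simp [sesq, anti, Ne.symm hl]
  rw [this]
  exact rank_vecMulVec_le _ _

lemma not_linearlyEquivalent_four (hn : 2 ≤ n) {e : Exceptional} (he : e ≠ .four) :
    ¬ LinearlyEquivalent (e.sesq hn) (e.anti hn)
      (Exceptional.four.sesq hn) (Exceptional.four.anti hn) := by
  rintro ⟨T, c, hc, h⟩
  have h1 := (h fun _ => 1).1
  have h2 : hermPart (e.sesq hn) (fun _ => 1) = 0 := by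
    rw [Exceptional.sesq, hermPart_zero] at h1
    exact (mul_eq_zero.1 h1.symm).resolve_left hc
  cases e <;> simp [Exceptional.sesq, hermPart_single] at h2 he

lemma not_linearlyEquivalent_two_one (hn : 2 ≤ n) :
    ¬ LinearlyEquivalent (Exceptional.two.sesq hn) (Exceptional.two.anti hn)
      (Exceptional.one.sesq hn) (Exceptional.one.anti hn) := by
  rintro ⟨T, c, hc, h⟩
  have h1 := (h (T.symm fun _ => 1)).2
  simp [Exceptional.anti, antiPart_single, antiPart_zero] at h1

/-- The form `z̄₁ z₂` takes every complex value, while multiples of `|z₁|²` stay on a ray. Leaving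
`B` arbitrary covers both (1) and (2). -/
lemma not_linearlyEquivalent_three (hn : 2 ≤ n) (a : ℝ≥0) {B : Matrix (Fin n) (Fin n) ℂ} :
    ¬ LinearlyEquivalent ((Exceptional.three a).sesq hn) ((Exceptional.three a).anti hn)
      (single ⟨0, by omega⟩ ⟨1, by omega⟩ 1) B := by
  rintro ⟨T, c, hc, h⟩
  have key : ∀ y : ℂ, ∃ r : ℝ, 0 ≤ r ∧ y = c * r := by
    intro y
    have h1 := (h (T.symm (Pi.single ⟨0, by omega⟩ 1 + Pi.single ⟨1, by omega⟩ y))).1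
    rw [T.apply_symm_apply] at h1
    simp only [Exceptional.sesq, hermPart_single, conj_mul'] at h1
    refine ⟨‖T.symm (Pi.single ⟨0, by omega⟩ 1 + Pi.single ⟨1, by omega⟩ y) ⟨0, by omega⟩‖ ^ 2,
      sq_nonneg _, ?_⟩
    push_cast
    rw [← h1]
    simp
  obtain ⟨r, hr, h1⟩ := key 1
  obtain ⟨s, hs, h2⟩ := key (-1)
  have h3 : c * ((r + s : ℝ) : ℂ) = 0 := by
    push_cast
    linear_combination -h1 - h2
  have h4 : r + s = 0 := ofReal_eq_zero.1 ((mul_eq_zero.1 h3).resolve_left hc)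
  have h5 : r = 0 := by linarith
  simp [h5] at h1

/-- At the first unit vector, let `x` be the first coordinate of its image: `|x|² = c` and `b x̄² =
c a`. Absolute values give `a = b`. -/
lemma LinearlyEquivalent.eq_of_three (hn : 2 ≤ n) {a b : ℝ≥0}
    (h : LinearlyEquivalent ((Exceptional.three a).sesq hn) ((Exceptional.three a).anti hn)
      ((Exceptional.three b).sesq hn) ((Exceptional.three b).anti hn)) : a = b := by
  obtain ⟨T, c, hc, h⟩ := h
  obtain ⟨h1, h2⟩ := h (Pi.single ⟨0, by omega⟩ 1)
  simp only [Exceptional.sesq, Exceptional.anti, hermPart_single, antiPart_single,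
    Pi.single_eq_same, map_one, mul_one, one_pow, conj_ofReal] at h1 h2
  have h3 := congrArg norm h1
  have h4 := congrArg norm h2
  simp only [norm_mul, norm_pow, RCLike.norm_conj, norm_real, Real.norm_of_nonneg a.coe_nonneg,
    Real.norm_of_nonneg b.coe_nonneg] at h3 h4
  rw [pow_two, h3, mul_comm] at h4
  exact (NNReal.eq (mul_left_cancel₀ (norm_ne_zero_iff.2 hc) h4)).symm

theorem Exceptional.eq_of_linearlyEquivalent (hn : 2 ≤ n) {e e' : Exceptional}
    (h : LinearlyEquivalent (e.sesq hn) (e.anti hn) (e'.sesq hn) (e'.anti hn)) : e = e' := by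
  cases e <;> cases e'
  case one.one => rfl
  case one.two => exact absurd h.symm (not_linearlyEquivalent_two_one hn)
  case one.three => exact absurd h.symm (not_linearlyEquivalent_three hn _)
  case one.four => exact absurd h (not_linearlyEquivalent_four hn (by simp))
  case two.one => exact absurd h (not_linearlyEquivalent_two_one hn)
  case two.two => rfl
  case two.three => exact absurd h.symm (not_linearlyEquivalent_three hn _)
  case two.four => exact absurd h (not_linearlyEquivalent_four hn (by simp))
  case three.one => exact absurd h (not_linearlyEquivalent_three hn _)
  case three.two => exact absurd h (not_linearlyEquivalent_three hn _)
  case three.three => rw [h.eq_of_three hn]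
  case three.four => exact absurd h (not_linearlyEquivalent_four hn (by simp))
  case four.one => exact absurd h.symm (not_linearlyEquivalent_four hn (by simp))
  case four.two => exact absurd h.symm (not_linearlyEquivalent_four hn (by simp))
  case four.three => exact absurd h.symm (not_linearlyEquivalent_four hn (by simp))
  case four.four => rfl

end ExceptionalQuadrics

/-! ### Normal forms in rank at most one. -/

section NormalForms

variable {n : ℕ} {A B : Matrix (Fin n) (Fin n) ℂ}

lemma exists_linearEquiv_rows {k : ℕ} (hk : k ≤ n) {u : Fin k → Fin n → ℂ}
    (hu : LinearIndependent ℂ u) :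
    ∃ L : (Fin n → ℂ) ≃ₗ[ℂ] (Fin n → ℂ), ∀ i z, L z (Fin.castLE hk i) = u i ⬝ᵥ z := by
  classical
  let b := Module.Basis.sumExtend hu
  have : Finite (Fin k ⊕ Module.Basis.sumExtendIndex hu) := Module.Finite.finite_basis b
  have : Finite (Module.Basis.sumExtendIndex hu) := Finite.sum_right (Fin k)
  cases nonempty_fintype (Module.Basis.sumExtendIndex hu)
  have hcard := Module.finrank_eq_card_basis b
  rw [Module.finrank_fin_fun, Fintype.card_sum, Fintype.card_fin] at hcard
  let e : Fin k ⊕ Module.Basis.sumExtendIndex hu ≃ Fin n :=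
    ((Equiv.refl _).sumCongr (Fintype.equivFin _)).trans
      (finSumFinEquiv.trans (finCongr hcard.symm))
  have he : ∀ i, e.symm (Fin.castLE hk i) = .inl i := by
    intro i
    rw [Equiv.symm_apply_eq]
    rfl
  let S : Matrix (Fin n) (Fin n) ℂ := Matrix.of fun i => b (e.symm i)
  have hS : IsUnit S := by
    rw [← Matrix.linearIndependent_rows_iff_isUnit]
    exact b.linearIndependent.comp _ e.symm.injective
  have hbij : Function.Bijective S.mulVecLin :=
    ⟨Matrix.mulVec_injective_iff_isUnit.2 hS, Matrix.mulVec_surjective_iff_isUnit.2 hS⟩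
  refine ⟨LinearEquiv.ofBijective S.mulVecLin hbij, fun i z => ?_⟩
  change b (e.symm (Fin.castLE hk i)) ⬝ᵥ z = _
  rw [he]
  congr 1
  simp only [b, Module.Basis.sumExtend, Module.Basis.reindex_apply, Module.Basis.extend_apply_self]
  rfl

/-- A matrix of rank at most one is an outer product `v rᵗ`. Symmetry of `B` forces its half of `v`
to be proportional to `r`, with the factor read off at an index where `r` is nonzero. -/
lemma exists_factorization (hB : B.IsSymm)
    (hr : ¬ 2 ≤ (Matrix.fromRows A.conjTranspose B).rank) (h0 : A ≠ 0 ∨ B ≠ 0) :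
    ∃ (r α : Fin n → ℂ) (b : ℂ), r ≠ 0 ∧ (∀ k j, A k j = conj (r k) * α j) ∧
      (∀ k j, conj (B k j) = b * (conj (r k) * conj (r j))) ∧ (α ≠ 0 ∨ b ≠ 0) := by
  have hr1 : Module.finrank ℂ (LinearMap.range (Matrix.fromRows A.conjTranspose B).mulVecLin) ≤ 1 := by
    change (Matrix.fromRows A.conjTranspose B).rank ≤ 1
    omega
  obtain ⟨v', hv⟩ := finrank_le_one_iff.1 hr1
  set v := v'.1
  choose r hr2 using fun l => hv ⟨_, LinearMap.mem_range_self _ (Pi.single l 1)⟩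
  have hM : ∀ s l, Matrix.fromRows A.conjTranspose B s l = v s * r l := by
    intro s l
    have := congrFun (congrArg Subtype.val (hr2 l)) s
    simp only [Matrix.mulVecLin_apply, Matrix.mulVec_single_one] at this
    rw [mul_comm]
    exact this.symm
  have hA : ∀ k j, A k j = conj (r k) * conj (v (.inl j)) := by
    intro k j
    have := congrArg conj (hM (.inl j) k)
    rw [Matrix.fromRows_apply_inl, Matrix.conjTranspose_apply, ← starRingEnd_apply, conj_conj,
      map_mul] at this
    rw [this, mul_comm]
  have hB1 : ∀ k j, B k j = v (.inr k) * r j := fun k j => hM (.inr k) j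
  have hr0 : r ≠ 0 := by
    rintro rfl
    rcases h0 with h0 | h0
    · exact h0 (by ext k j; simp [hA])
    · exact h0 (by ext k j; simp [hB1])
  obtain ⟨l, hl⟩ := Function.ne_iff.1 hr0
  have hl : r l ≠ 0 := hl
  have hB2 : ∀ k j, conj (B k j) = conj (v (.inr l) / r l) * (conj (r k) * conj (r j)) := by
    intro k j
    rw [← map_mul, ← map_mul]
    congr 1
    have := hB.apply k l
    rw [hB1, hB1] at this
    rw [hB1]
    field_simp
    linear_combination -r j * this
  refine ⟨r, _, _, hr0, hA, hB2, ?_⟩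
  by_contra! h
  rcases h0 with h0 | h0
  · refine h0 (Matrix.ext fun k j => ?_)
    have := congrFun h.1 j
    simp only [Pi.zero_apply] at this
    rw [hA, this, mul_zero, Matrix.zero_apply]
  · refine h0 (Matrix.ext fun k j => ?_)
    rw [← conj_conj (B k j), hB2, h.2, zero_mul, map_zero, Matrix.zero_apply]

/-- The map `(z, w) ↦ (L z, c⁻¹ (w - P z))` is globally biholomorphic and fixes the origin, so it
serves both notions. -/
lemma biholomorphic_of_linear {ρ ρ' P : (Fin n → ℂ) → ℂ} (L : (Fin n → ℂ) ≃ₗ[ℂ] (Fin n → ℂ))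
    {c : ℂ} (hc : c ≠ 0) (hP : Differentiable ℂ P) (hP0 : P 0 = 0)
    (h : ∀ z, ρ z = c * ρ' (L z) + P z) :
    LocallyBiholomorphic (graph ρ) (graph ρ') ∧ GloballyBiholomorphic (graph ρ) (graph ρ') := by
  let φ : (Fin n → ℂ) × ℂ ≃ (Fin n → ℂ) × ℂ :=
    { toFun := fun x => (L x.1, c⁻¹ * (x.2 - P x.1))
      invFun := fun y => (L.symm y.1, c * y.2 + P (L.symm y.1))
      left_inv := fun x => by simp [hc]
      right_inv := fun y => by simp [hc] }
  have hL : Differentiable ℂ L := (LinearMap.toContinuousLinearMap (L : (Fin n → ℂ) →ₗ[ℂ] (Fin n → ℂ))).differentiable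
  have hL' : Differentiable ℂ L.symm :=
    (LinearMap.toContinuousLinearMap (L.symm : (Fin n → ℂ) →ₗ[ℂ] (Fin n → ℂ))).differentiable
  have hφ : Differentiable ℂ φ := (hL.comp differentiable_fst).prodMk
    ((differentiable_snd.sub (hP.comp differentiable_fst)).const_mul _)
  have hφ' : Differentiable ℂ φ.symm := (hL'.comp differentiable_fst).prodMk
    ((differentiable_snd.const_mul _).add (hP.comp (hL'.comp differentiable_fst)))
  have hM : ∀ x, φ x ∈ graph ρ' ↔ x ∈ graph ρ := by
    intro x
    change c⁻¹ * (x.2 - P x.1) = ρ' (L x.1) ↔ x.2 = ρ x.1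
    rw [h, inv_mul_eq_iff_eq_mul₀ hc, sub_eq_iff_eq_add]
  refine ⟨⟨Homeomorph.toOpenPartialHomeomorph ⟨φ, hφ.continuous, hφ'.continuous⟩, Set.mem_univ _,
    ?_, hφ.differentiableOn, hφ'.differentiableOn, fun x _ => hM x⟩, φ, hφ, hφ', ?_⟩
  · change φ 0 = 0
    simp [φ, hP0]
  · ext y
    rw [Set.mem_image_equiv, ← hM, φ.apply_symm_apply]

lemma differentiable_holPart (C₀ : Matrix (Fin n) (Fin n) ℂ) : Differentiable ℂ (holPart C₀) := by
  unfold holPart dotProduct Matrix.mulVec dotProduct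
  fun_prop

/-- A quadric with `rank ≤ 1` has the normal form of an exceptional quadric. -/
theorem exists_biholomorphic_exceptional (hn : 2 ≤ n) (hB : B.IsSymm)
    (C₀ : Matrix (Fin n) (Fin n) ℂ)
    (hr : ¬ 2 ≤ (Matrix.fromRows A.conjTranspose B).rank) (h0 : A ≠ 0 ∨ B ≠ 0) :
    ∃ e : Exceptional, LocallyBiholomorphic (graph (quadric A B C₀)) (graph (e.fn hn)) ∧
      GloballyBiholomorphic (graph (quadric A B C₀)) (graph (e.fn hn)) := by
  obtain ⟨r, α, b, hr0, hA, hB', h0⟩ := exists_factorization hB hr h0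
  have hQ : ∀ z, quadric A B C₀ z =
      conj (r ⬝ᵥ z) * (α ⬝ᵥ z) + b * conj (r ⬝ᵥ z) ^ 2 + holPart C₀ z := by
    intro z
    have hAz : A.mulVec z = (α ⬝ᵥ z) • star r := by
      ext k
      simp only [Matrix.mulVec, dotProduct, hA, Pi.smul_apply, Pi.star_apply, smul_eq_mul,
        Finset.sum_mul, starRingEnd_apply]
      exact Finset.sum_congr rfl fun j _ => by ring
    have hBz : B.mulVec z = (conj b * (r ⬝ᵥ z)) • r := by
      ext k
      simp only [Matrix.mulVec, dotProduct, Pi.smul_apply, smul_eq_mul, Finset.sum_mul,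
        Finset.mul_sum]
      refine Finset.sum_congr rfl fun j _ => ?_
      rw [← conj_conj (B k j), hB', map_mul, map_mul, conj_conj, conj_conj]
      ring
    rw [quadric_eq_add, hermPart, antiPart, hAz, hBz, dotProduct_smul, dotProduct_smul,
      Matrix.star_dotProduct_star, dotProduct_comm z r, starRingEnd_apply]
    simp only [smul_eq_mul, ← starRingEnd_apply, map_mul, conj_conj]
    ring
  have hP0 : holPart C₀ 0 = 0 := by simp [holPart]
  suffices ∃ (e : Exceptional) (L : (Fin n → ℂ) ≃ₗ[ℂ] (Fin n → ℂ)) (c : ℂ), c ≠ 0 ∧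
      ∀ z, conj (r ⬝ᵥ z) * (α ⬝ᵥ z) + b * conj (r ⬝ᵥ z) ^ 2 = c * e.fn hn (L z) by
    obtain ⟨e, L, c, hc, h⟩ := this
    exact ⟨e, biholomorphic_of_linear L hc (differentiable_holPart C₀) hP0
      fun z => by rw [hQ, h]⟩
  -- If `α` is a multiple of `r`, one coordinate suffices, giving (3) or (4); otherwise `r` and `α`
  -- provide two coordinates, giving (1) or (2).
  by_cases hdep : ∃ a : ℂ, a • r = α
  · obtain ⟨a, rfl⟩ := hdep
    have hone : ∀ ω : ℂ, ω ≠ 0 → ∃ L : (Fin n → ℂ) ≃ₗ[ℂ] (Fin n → ℂ),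
        ∀ z, L z ⟨0, by omega⟩ = ω * (r ⬝ᵥ z) := by
      intro ω hω
      obtain ⟨L, hL⟩ := exists_linearEquiv_rows (k := 1) (by omega) (u := fun _ => ω • r)
        (linearIndependent_unique_iff.2 (smul_ne_zero hω hr0))
      exact ⟨L, fun z => (hL 0 z).trans (by rw [smul_dotProduct, smul_eq_mul])⟩
    by_cases ha : a = 0
    · have hb : b ≠ 0 := by simpa [ha] using h0
      obtain ⟨L, hL⟩ := hone 1 one_ne_zero
      refine ⟨.four, L, b, hb, fun z => ?_⟩
      simp [Exceptional.fn, hL, ha]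
    -- A rotation by half the argument of `b / a`: it keeps `|z₁|²` and turns the coefficient of
    -- `z̄₁²` into `|b / a|`.
    · set ω : ℂ := exp (-((b / a).arg / 2 : ℝ) * I)
      have hω : conj ω * ω = 1 := by
        rw [conj_mul']
        simp [ω, ← ofReal_neg, norm_exp_ofReal_mul_I, -ofReal_div]
      have hω2 : (‖b / a‖ : ℂ) * conj ω ^ 2 = b / a := by
        have : conj ω ^ 2 = exp ((b / a).arg * I) := by
          rw [← exp_conj, ← exp_nat_mul]
          congr 1
          simp only [map_mul, map_neg, conj_ofReal, conj_I]
          push_cast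
          ring
        rw [this]
        exact norm_mul_exp_arg_mul_I _
      obtain ⟨L, hL⟩ := hone ω (exp_ne_zero _)
      refine ⟨.three ‖b / a‖₊, L, a, ha, fun z => ?_⟩
      simp only [Exceptional.fn, hL, coe_nnnorm, ofReal_pow, ← conj_mul', map_mul,
        smul_dotProduct, smul_eq_mul]
      have hb : b = a * ((‖b / a‖ : ℂ) * conj ω ^ 2) := by rw [hω2]; field_simp
      linear_combination conj (r ⬝ᵥ z) ^ 2 * hb - a * conj (r ⬝ᵥ z) * (r ⬝ᵥ z) * hω
  · have htwo : ∀ s : ℂ, s ≠ 0 → ∃ L : (Fin n → ℂ) ≃ₗ[ℂ] (Fin n → ℂ),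
        ∀ z, L z ⟨0, by omega⟩ = r ⬝ᵥ z ∧ L z ⟨1, by omega⟩ = s * (α ⬝ᵥ z) := by
      intro s hs
      have hli : LinearIndependent ℂ ![r, s • α] := by
        rw [LinearIndependent.pair_iff' hr0]
        intro a ha
        refine hdep ⟨s⁻¹ * a, ?_⟩
        rw [mul_smul, ha, inv_smul_smul₀ hs]
      obtain ⟨L, hL⟩ := exists_linearEquiv_rows hn hli
      exact ⟨L, fun z => ⟨hL 0 z, (hL 1 z).trans (by simp)⟩⟩
    by_cases hb : b = 0
    · obtain ⟨L, hL⟩ := htwo 1 one_ne_zero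
      refine ⟨.two, L, 1, one_ne_zero, fun z => ?_⟩
      simp [Exceptional.fn, hL, hb]
    · obtain ⟨L, hL⟩ := htwo b⁻¹ (inv_ne_zero hb)
      refine ⟨.one, L, b, hb, fun z => ?_⟩
      simp only [Exceptional.fn, hL]
      field_simp

end NormalForms

/-! ### The implications between (a), (b) and (c). -/

section Equivalences

open MvPolynomial

variable {n : ℕ} {A B C₀ : Matrix (Fin n) (Fin n) ℂ}

theorem representation_of_rank (hB : B.IsSymm)
    (hr : 2 ≤ (Matrix.fromRows A.conjTranspose B).rank)
    {f : MvPolynomial (Fin n ⊕ Fin n) ℂ} (hf : IsCR (quadric A B C₀) (evalBar f)) :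
    (∃! F : MvPolynomial (Fin n ⊕ Unit) ℂ,
        ∀ z, evalBar f z = evalHol F z (quadric A B C₀ z)) ∧
      ∀ F : MvPolynomial (Fin n ⊕ Unit) ℂ,
        (∀ z, evalBar f z = evalHol F z (quadric A B C₀ z)) →
          MvPolynomial.weightedTotalDegree weight F = f.totalDegree ∧
          ∀ d : ℕ, f.IsHomogeneous d → F.IsWeightedHomogeneous weight d := by
  have hiff : ∀ F : MvPolynomial (Fin n ⊕ Unit) ℂ,
      (∀ z, evalBar f z = evalHol F z (quadric A B C₀ z)) ↔
        substHom (quadricPoly A B C₀) F = f := by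
    intro F
    simp only [← evalBar_quadricPoly, ← evalBar_substHom]
    exact ⟨fun h => evalBar_injective (funext fun z => (h z).symm), fun h z => by rw [h]⟩
  obtain ⟨k, hk⟩ := exists_barGrad_ne_zero hr hB
  rw [← pderiv_quadricPoly A C₀ hB] at hk
  have hq := isHomogeneous_quadricPoly A B C₀
  simp only [hiff]
  constructor
  · obtain ⟨F, hF⟩ := mem_range_substHom hr hB C₀ f (IsCR.pderiv_mul_barGrad C₀ hB hf)
    exact ⟨F, hF, fun G hG => substHom_injective hk (hG.trans hF.symm)⟩
  · rintro F rfl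
    exact ⟨totalDegree_substHom hq hk F, fun d hd => isWeightedHomogeneous_of_substHom hq hk hd⟩

lemma exists_linear_polynomial (h : (Fin n → ℂ) →ₗ[ℝ] ℂ) :
    ∃ f : MvPolynomial (Fin n ⊕ Fin n) ℂ, f.IsHomogeneous 1 ∧ evalBar f = h := by
  -- The Wirtinger derivatives of `h`.
  let a : Fin n → ℂ := fun j => 1 / 2 * (h (Pi.single j 1) - I * h (Pi.single j I))
  let b : Fin n → ℂ := fun j => 1 / 2 * (h (Pi.single j 1) + I * h (Pi.single j I))
  refine ⟨∑ j, (C (a j) * X (.inl j) + C (b j) * X (.inr j)), ?_, ?_⟩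
  · have h : ∀ (a : ℂ) (r : Fin n ⊕ Fin n),
        (C a * X r : MvPolynomial (Fin n ⊕ Fin n) ℂ).IsHomogeneous 1 := fun a r => by
      simpa using (isHomogeneous_C _ a).mul (isHomogeneous_X ℂ r)
    exact IsHomogeneous.sum _ _ _ fun j _ => (h _ _).add (h _ _)
  · funext z
    have hz : z = ∑ j, ((z j).re • (Pi.single j 1 : Fin n → ℂ) +
        (z j).im • (Pi.single j I : Fin n → ℂ)) := by
      conv_lhs => rw [← Finset.univ_sum_single z]
      refine Finset.sum_congr rfl fun j _ => ?_
      rw [← Pi.single_smul, ← Pi.single_smul, ← Pi.single_add, real_smul, real_smul, mul_one,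
        re_add_im]
    conv_rhs => rw [hz]
    simp only [evalBar, map_sum, map_add, map_mul, eval_C, eval_X, Sum.elim_inl, Sum.elim_inr,
      map_smul, real_smul]
    refine Finset.sum_congr rfl fun j _ => ?_
    simp only [a, b]
    have h1 : z j + conj (z j) = 2 * (z j).re := by rw [add_conj]; push_cast; ring
    have h2 : z j - conj (z j) = 2 * (z j).im * I := by rw [sub_conj]; push_cast; ring
    linear_combination h (Pi.single j 1) / 2 * h1 - I * h (Pi.single j I) / 2 * h2 -
      (z j).im * h (Pi.single j I) * I_mul_I

/-- The variable `w` has weight two, so it cannot occur in a polynomial of weight one. -/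
theorem differentiable_of_representation {F : MvPolynomial (Fin n ⊕ Unit) ℂ}
    (hF : F.IsWeightedHomogeneous weight 1) {ρ h : (Fin n → ℂ) → ℂ}
    (hh : ∀ z, h z = evalHol F z (ρ z)) : Differentiable ℂ h := by
  have h1 : ∀ k, pderiv (.inr k) F = 0 := by
    intro k
    ext m
    rw [coeff_pderiv, coeff_zero]
    by_contra hne
    have := hF (left_ne_zero_of_mul hne)
    rw [map_add, Finsupp.weight_single] at this
    simp [weight] at this
  obtain ⟨G, rfl⟩ := exists_rename_of_pderiv_eq_zero h1
  have h2 : h = fun z => eval z G := by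
    funext z
    rw [hh, evalHol, eval_rename]
    rfl
  rw [h2]
  exact fun z => (AnalyticOnNhd.eval_mvPolynomial G z trivial).differentiableAt

/-- The witness is `conj(r·z)`: by the factorization `Qₖ = conj(rₖ) (α·z + 2b conj(r·z))`, so `∂̄Q`
is a multiple of its `∂̄`. -/
theorem exists_nonholomorphic_CR (hB : B.IsSymm)
    (hr : ¬ 2 ≤ (Matrix.fromRows A.conjTranspose B).rank) {k : Fin n} {z₀ : Fin n → ℂ}
    (h₀ : evalBar (barGrad A B k) z₀ ≠ 0) (hne : A ≠ 0 ∨ B ≠ 0) :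
    ∃ h : (Fin n → ℂ) →ₗ[ℝ] ℂ, IsCR (quadric A B C₀) h ∧ ¬ Differentiable ℂ h := by
  obtain ⟨r, α, b, hr0, hA, hB', -⟩ := exists_factorization hB hr hne
  let h : (Fin n → ℂ) →ₗ[ℝ] ℂ :=
    conjLIE.toLinearEquiv.toLinearMap ∘ₗ (dotProductBilin ℂ ℂ r).restrictScalars ℝ
  have hh : ∀ u, h u = conj (r ⬝ᵥ u) := fun u => rfl
  have hfd : ∀ z u, fderiv ℝ h z u = h u := by
    intro z u
    have : HasFDerivAt h (LinearMap.toContinuousLinearMap h) z :=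
      (LinearMap.toContinuousLinearMap h).hasFDerivAt
    rw [this.fderiv]
    rfl
  have hI : ∀ u, h (I • u) = -I * h u := by
    intro u
    rw [hh, hh, dotProduct_smul, smul_eq_mul, map_mul, conj_I]
  refine ⟨h, isCR_of_proportional C₀ hB h₀ fun z => ⟨α ⬝ᵥ z + 2 * b * conj (r ⬝ᵥ z), fun u => ?_⟩,
    fun hd => ?_⟩
  · rw [act_quadric C₀ hB, act_delBar, hfd, hfd, hI]
    have e : ∀ k, evalBar (barGrad A B k) z =
        conj (r k) * (α ⬝ᵥ z + 2 * b * conj (r ⬝ᵥ z)) := by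
      intro k
      rw [evalBar_barGrad, Finset.sum_add_distrib, mul_add]
      simp only [dotProduct, map_sum, map_mul, Finset.mul_sum, hA, hB']
      congr 1 <;> exact Finset.sum_congr rfl fun j _ => by ring
    have e2 : h u = ∑ k, conj (u k) * conj (r k) := by
      rw [hh, dotProduct, map_sum]
      exact Finset.sum_congr rfl fun j _ => by rw [map_mul, mul_comm]
    simp only [e, ← mul_assoc, ← Finset.sum_mul, ← e2]
    linear_combination (α ⬝ᵥ z + 2 * b * conj (r ⬝ᵥ z)) * h u / 2 * I_mul_I
  · obtain ⟨l, hl⟩ := Function.ne_iff.1 hr0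
    have h1 := (hd 0).hasFDerivAt.restrictScalars ℝ
    have h2 : ∀ u, h u = fderiv ℂ h 0 u := fun u => by rw [← hfd 0 u, h1.fderiv]; rfl
    have h3 := hI (Pi.single l 1)
    rw [h2, map_smul, ← h2, smul_eq_mul] at h3
    have h4 : 2 * I * h (Pi.single l 1) = 0 := by linear_combination h3
    have h5 := (mul_eq_zero.1 h4).resolve_left (by simp)
    rw [hh, dotProduct_single, mul_one, map_eq_zero] at h5
    exact hl h5

end Equivalences

end CRQuadric

open CRQuadric
theorem theorem1p2 (n : ℕ) (hn : 2 ≤ n) :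
    (∀ A B C : Matrix (Fin n) (Fin n) ℂ, B.IsSymm → C.IsSymm →
      -- the antiholomorphic differential of `Q` does not vanish identically
      (∃ z : Fin n → ℂ, ∃ k : Fin n,
        act (quadric A B C) z (delBar (Pi.single k (1 : ℂ))) ≠ 0) →
      List.TFAE [
        -- (a)
        2 ≤ (Matrix.fromRows A.conjTranspose B).rank,
        -- (b)
        ∀ f : MvPolynomial (Fin n ⊕ Fin n) ℂ, IsCR (quadric A B C) (evalBar f) →
          (∃! F : MvPolynomial (Fin n ⊕ Unit) ℂ,
            ∀ z, evalBar f z = evalHol F z (quadric A B C z)) ∧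
          ∀ F : MvPolynomial (Fin n ⊕ Unit) ℂ,
            (∀ z, evalBar f z = evalHol F z (quadric A B C z)) →
              MvPolynomial.weightedTotalDegree weight F = f.totalDegree ∧
              ∀ d : ℕ, f.IsHomogeneous d → F.IsWeightedHomogeneous weight d,
        -- (c)
        ∀ h : (Fin n → ℂ) →ₗ[ℝ] ℂ, IsCR (quadric A B C) h → Differentiable ℂ h,
        -- (d), for local equivalence at the origin
        ¬ ∃ e : Exceptional,
          LocallyBiholomorphic (graph (quadric A B C)) (graph (e.fn hn)),
        -- (d), for global equivalence
        ¬ ∃ e : Exceptional,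
          GloballyBiholomorphic (graph (quadric A B C)) (graph (e.fn hn))]) ∧
    -- the exceptional quadrics are mutually inequivalent, in both senses
    (∀ e e' : Exceptional, e ≠ e' →
      ¬ LocallyBiholomorphic (graph (e.fn hn)) (graph (e'.fn hn)) ∧
      ¬ GloballyBiholomorphic (graph (e.fn hn)) (graph (e'.fn hn))) := by
  have hlin : ∀ (A B C : Matrix (Fin n) (Fin n) ℂ) (e : Exceptional),
      LocallyBiholomorphic (graph (quadric A B C)) (graph (e.fn hn)) ∨
        GloballyBiholomorphic (graph (quadric A B C)) (graph (e.fn hn)) →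
      LinearlyEquivalent A B (e.sesq hn) (e.anti hn) := by
    intro A B C e h
    rw [e.fn_eq_quadric] at h
    exact h.elim (fun h => h.linearlyEquivalent) fun h => h.linearlyEquivalent
  constructor
  · intro A B C hB _ hQ
    obtain ⟨z₀, k, h₀⟩ := hQ
    rw [act_quadric_single C hB] at h₀
    have hne : A ≠ 0 ∨ B ≠ 0 := by
      by_contra! h
      simp [evalBar_barGrad, h.1, h.2] at h₀
    have hrank : 2 ≤ (Matrix.fromRows A.conjTranspose B).rank → ∀ e : Exceptional,
        ¬ LinearlyEquivalent A B (e.sesq hn) (e.anti hn) := by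
      intro hr e he
      have := he.rank_le hB (e.anti_isSymm hn)
      have := e.rank_le_one hn
      omega
    tfae_have 1 → 2 := fun hr f hf => representation_of_rank hB hr hf
    tfae_have 2 → 3 := by
      intro hb h hh
      obtain ⟨f, hf, hfh⟩ := exists_linear_polynomial h
      rw [← hfh] at hh ⊢
      obtain ⟨⟨F, hF, -⟩, hdeg⟩ := hb f hh
      exact differentiable_of_representation ((hdeg F hF).2 1 hf) hF
    tfae_have 3 → 1 := by
      intro hc
      by_contra hr
      obtain ⟨h, hh, hd⟩ := exists_nonholomorphic_CR (C₀ := C) hB hr h₀ hne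
      exact hd (hc h hh)
    tfae_have 1 → 4 := fun hr ⟨e, he⟩ => hrank hr e (hlin A B C e (.inl he))
    tfae_have 1 → 5 := fun hr ⟨e, he⟩ => hrank hr e (hlin A B C e (.inr he))
    tfae_have 4 → 1 := by
      intro hl
      by_contra hr
      obtain ⟨e, he, -⟩ := exists_biholomorphic_exceptional hn hB C hr hne
      exact hl ⟨e, he⟩
    tfae_have 5 → 1 := by
      intro hl
      by_contra hr
      obtain ⟨e, -, he⟩ := exists_biholomorphic_exceptional hn hB C hr hne
      exact hl ⟨e, he⟩
    tfae_finish
  · intro e e' hee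
    have := hlin (e.sesq hn) (e.anti hn) 0 e'
    rw [← e.fn_eq_quadric] at this
    exact ⟨fun h => hee (Exceptional.eq_of_linearlyEquivalent hn (this (.inl h))),
      fun h => hee (Exceptional.eq_of_linearlyEquivalent hn (this (.inr h)))⟩
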